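/- Let $n\ge 2$. For an open set $\Omega\subseteq\mathbb R^n$ let $BD(\Omega)$ be the set of all $u\in L^1(\Omega;\mathbb R^n)$ whose symmetrized distributional gradient $Eu=\tfrac12(Du+Du^T)$ is a finite matrix-valued Radon measure on $\Omega$. For $u\in BD(\Omega)$ let $J_u$ be the set of jump points of $u$, i.e. of those $x\in\Omega$ for which there are $u_+\neq u_-$ in $\mathbb R^n$ and a unit vector $\nu$ with $$\lim_{r\to0}\frac1{\mathcal L^n(B_r)}\int_{B_r(x)\cap\{\pm(y-x)\cdot\nu>0\}}|u(y)-u_\pm|\,dy=0 ,$$ let $E^su$ be the part of $Eu$ that is singular with respect to the Lebesgue measure $\mathcal L^n$, and let $E^cu$, the Cantor part of $Eu$, be the restriction of $E^su$ to $\Omega\setminus J_u$. Let $\nabla u(x)$ denote the approximate gradient of $u$ at $x$, i.e. the matrix $L$ such that, for some $z\in\mathbb R^n$, $$\lim_{r\to0}\frac1{\mathcal L^n(B_r)}\int_{B_r(x)}\frac{|u(y)-z-L(y-x)|}{r}\,dy=0 .$$ Finally, let $GBV(\Omega;\mathbb R^n)$ be the set of all measurable $u:\Omega\to\mathbb R^n$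 such that $\phi\circ u\in BV_{\mathrm{loc}}(\Omega)$ for every $\phi\in C^1(\mathbb R^n)$ whose gradient has compact support. **Theorem.** For every nonempty open set $\Omega\subseteq\mathbb R^n$, $n\ge2$, there is $u\in BD(\Omega)\cap L^\infty(\Omega;\mathbb R^n)$ such that $Eu=E^cu$, the approximate gradient $\nabla u$ exists $\mathcal L^n$-almost everywhere in $\Omega$ and $\nabla u\notin L^1(\Omega;\mathbb R^{n\times n})$, and $u\notin GBV(\Omega;\mathbb R^n)$. -/

import Mathlib

open MeasureTheory Set Filter Topology
open scoped ContDiff ENNReal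

/-- `ℝⁿ` with its Euclidean norm. -/
abbrev RSpace (n : ℕ) : Type := EuclideanSpace ℝ (Fin n)

/-- The partial derivative `∂ⱼ φ (x)`. -/
noncomputable def partialDeriv {n : ℕ} (j : Fin n) (φ : RSpace n → ℝ) (x : RSpace n) : ℝ :=
  fderiv ℝ φ x (EuclideanSpace.single j 1)

/-- Test functions on `Ω`: smooth functions whose support is compact and contained in `Ω`. -/
def IsTestFn {n : ℕ} (Ω : Set (RSpace n)) (φ : RSpace n → ℝ) : Prop :=
  ContDiff ℝ ∞ φ ∧ HasCompactSupport φ ∧ tsupport φ ⊆ Ω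

/-- `Du = μ` for a scalar function `f` on `Ω`: the distributional partial derivatives of `f` are
the finite signed Borel measures `μ i`, which live on `Ω`. -/
def IsGradientMeasure {n : ℕ} (Ω : Set (RSpace n)) (f : RSpace n → ℝ)
    (μ : Fin n → SignedMeasure (RSpace n)) : Prop :=
  ∀ i, (μ i).restrict Ω = μ i ∧
    ∀ φ : RSpace n → ℝ, IsTestFn Ω φ →
      ∫ x in Ω, f x * partialDeriv i φ x = -∫ᵛ x, φ x ∂<•(μ i)

/-- `f ∈ BV(Ω)`: `f` is integrable on `Ω` and its distributional gradient is a finite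
vector-valued measure. -/
def InBV {n : ℕ} (Ω : Set (RSpace n)) (f : RSpace n → ℝ) : Prop :=
  IntegrableOn f Ω ∧ ∃ μ : Fin n → SignedMeasure (RSpace n), IsGradientMeasure Ω f μ

/-- `f ∈ BV_loc(Ω)`: `f ∈ BV(V)` for every open set `V` that is relatively compact in `Ω`. -/
def InBVLoc {n : ℕ} (Ω : Set (RSpace n)) (f : RSpace n → ℝ) : Prop :=
  ∀ V : Set (RSpace n), IsOpen V → IsCompact (closure V) → closure V ⊆ Ω → InBV V f

/-- `u ∈ GBV(Ω; ℝⁿ)`: `u` is measurable and `φ ∘ u ∈ BV_loc(Ω)` for all `φ ∈ C¹(ℝⁿ)` such that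
`∇φ` has compact support. -/
def InGBV {n : ℕ} (Ω : Set (RSpace n)) (u : RSpace n → RSpace n) : Prop :=
  AEStronglyMeasurable u (volume.restrict Ω) ∧
    ∀ φ : RSpace n → ℝ, ContDiff ℝ 1 φ → HasCompactSupport (fderiv ℝ φ) →
      InBVLoc Ω (fun x => φ (u x))

/-- `Eu = μ`, where `Eu = (Du + Duᵀ) / 2` in the sense of distributions on `Ω`: the entries of the
symmetrized distributional gradient are the finite signed Borel measures `μ i j`, which live
on `Ω`. -/
def IsStrainMeasure {n : ℕ} (Ω : Set (RSpace n)) (u : RSpace n → RSpace n)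
    (μ : Fin n → Fin n → SignedMeasure (RSpace n)) : Prop :=
  ∀ i j, (μ i j).restrict Ω = μ i j ∧
    ∀ φ : RSpace n → ℝ, IsTestFn Ω φ →
      ∫ x in Ω, (u x i * partialDeriv j φ x + u x j * partialDeriv i φ x) / 2
        = -∫ᵛ x, φ x ∂<•(μ i j)

/-- `u ∈ BD(Ω)`: `u ∈ L¹(Ω; ℝⁿ)` and `Eu` is a bounded matrix-valued measure on `Ω`. -/
def InBD {n : ℕ} (Ω : Set (RSpace n)) (u : RSpace n → RSpace n) : Prop :=
  IntegrableOn u Ω ∧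
    ∃ μ : Fin n → Fin n → SignedMeasure (RSpace n), IsStrainMeasure Ω u μ

/-- `x` is a jump point of `u`: there are `a ≠ b` and a unit vector `ν` such that, as `r → 0⁺`, the
integrals of `|u - a|` over `B_r(x) ∩ {(y - x) · ν > 0}` and of `|u - b|` over
`B_r(x) ∩ {(y - x) · ν < 0}`, divided by the volume of `B_r(x)`, tend to `0`. -/
def IsJumpPoint {n : ℕ} (u : RSpace n → RSpace n) (x : RSpace n) : Prop :=
  ∃ a b ν : RSpace n, a ≠ b ∧ ‖ν‖ = 1 ∧
    Tendsto (fun r : ℝ =>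
        (∫⁻ y in Metric.ball x r ∩ {y | 0 < inner ℝ (y - x) ν}, ‖u y - a‖ₑ)
          / volume (Metric.ball x r)) (𝓝[>] 0) (𝓝 0) ∧
    Tendsto (fun r : ℝ =>
        (∫⁻ y in Metric.ball x r ∩ {y | inner ℝ (y - x) ν < 0}, ‖u y - b‖ₑ)
          / volume (Metric.ball x r)) (𝓝[>] 0) (𝓝 0)

/-- The jump set `J_u` of a function `u` on `Ω`. -/
def jumpSet {n : ℕ} (Ω : Set (RSpace n)) (u : RSpace n → RSpace n) : Set (RSpace n) :=
  {x ∈ Ω | IsJumpPoint u x}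

/-- The Cantor part `Eᶜu` of the strain measure `μ = Eu`: the part of `μ` that is singular with
respect to the Lebesgue measure, restricted to the complement of the jump set in `Ω`. -/
noncomputable def cantorPart {n : ℕ} (Ω : Set (RSpace n)) (u : RSpace n → RSpace n)
    (μ : Fin n → Fin n → SignedMeasure (RSpace n)) :
    Fin n → Fin n → SignedMeasure (RSpace n) :=
  fun i j => ((μ i j).singularPart volume).restrict (Ω \ jumpSet Ω u)

/-- `L` is the approximate gradient `∇u(x)`: for some value `z` (the approximate limit of `u`
at `x`), the mean over `B_r(x)` of `|u(y) - z - L (y - x)| / r` tends to `0` as `r → 0⁺`. -/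
def HasApproxGradientAt {n : ℕ} (u : RSpace n → RSpace n) (L : RSpace n →L[ℝ] RSpace n)
    (x : RSpace n) : Prop :=
  ∃ z : RSpace n,
    Tendsto (fun r : ℝ =>
        (∫⁻ y in Metric.ball x r, ‖u y - z - L (y - x)‖ₑ / ENNReal.ofReal r)
          / volume (Metric.ball x r)) (𝓝[>] 0) (𝓝 0)

section RieszSigned

open scoped BoundedContinuousFunction NNReal CompactlySupported Pointwise

variable {X : Type*} [TopologicalSpace X]

/-- A compactly supported continuous function, as a bounded continuous one. -/
noncomputable def bcfOfCompact (f : X → ℝ) (hf : Continuous f) (h : HasCompactSupport f) :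
    X →ᵇ ℝ :=
  BoundedContinuousFunction.ofNormedAddCommGroup f hf
    (Classical.choose (h.exists_bound_of_continuous hf))
    (Classical.choose_spec (h.exists_bound_of_continuous hf))

/-- The bounded continuous function underlying a nonnegative compactly supported one. -/
noncomputable def toRealBCF (f : C_c(X, ℝ≥0)) : X →ᵇ ℝ :=
  bcfOfCompact (fun x => (f x : ℝ)) (NNReal.continuous_coe.comp f.continuous)
    (f.hasCompactSupport.comp_left (g := ((↑) : ℝ≥0 → ℝ)) rfl)

@[simp]
theorem toRealBCF_apply (f : C_c(X, ℝ≥0)) (x : X) : toRealBCF f x = f x := rfl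

/-- The values of a functional on the order interval `[0, f]`. -/
def dualValues (Λ : (X →ᵇ ℝ) →L[ℝ] ℝ) (f : X →ᵇ ℝ) : Set ℝ :=
  Λ '' {g | ∀ x, 0 ≤ g x ∧ g x ≤ f x}

theorem dualValues_le {Λ : (X →ᵇ ℝ) →L[ℝ] ℝ} {f : X →ᵇ ℝ} {v : ℝ} (hv : v ∈ dualValues Λ f) :
    v ≤ ‖Λ‖ * ‖f‖ := by
  obtain ⟨g, h, rfl⟩ := hv
  calc Λ g ≤ ‖Λ g‖ := le_abs_self _
    _ ≤ ‖Λ‖ * ‖g‖ := Λ.le_opNorm g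
    _ ≤ ‖Λ‖ * ‖f‖ := by
      gcongr
      refine (BoundedContinuousFunction.norm_le (norm_nonneg _)).2 fun x => ?_
      rw [Real.norm_eq_abs, abs_of_nonneg (h x).1]
      exact (h x).2.trans ((le_abs_self _).trans (f.norm_coe_le_norm x))

theorem dualValues_bddAbove (Λ : (X →ᵇ ℝ) →L[ℝ] ℝ) (f : X →ᵇ ℝ) : BddAbove (dualValues Λ f) :=
  ⟨_, fun _ => dualValues_le⟩

theorem zero_mem_dualValues (Λ : (X →ᵇ ℝ) →L[ℝ] ℝ) {f : X →ᵇ ℝ} (hf : ∀ x, 0 ≤ f x) :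
    0 ∈ dualValues Λ f :=
  ⟨0, fun x => ⟨le_rfl, hf x⟩, map_zero Λ⟩

theorem dualValues_add (Λ : (X →ᵇ ℝ) →L[ℝ] ℝ) {f g : X →ᵇ ℝ} (hf : ∀ x, 0 ≤ f x)
    (hg : ∀ x, 0 ≤ g x) :
    dualValues Λ (f + g) = dualValues Λ f + dualValues Λ g := by
  ext v
  constructor
  · rintro ⟨w, h, rfl⟩
    refine ⟨Λ (w ⊓ f), ⟨w ⊓ f, fun x => ⟨le_inf (h x).1 (hf x), inf_le_right⟩, rfl⟩,
      Λ (w - w ⊓ f), ⟨w - w ⊓ f, fun x => ⟨sub_nonneg.2 inf_le_left, ?_⟩, rfl⟩, by simp⟩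
    have h2 : w x ≤ f x + g x := (h x).2
    have h3 := hg x
    change w x - min (w x) (f x) ≤ g x
    rcases le_total (w x) (f x) with h | h
    · rw [min_eq_left h]; linarith
    · rw [min_eq_right h]; linarith
  · rintro ⟨_, ⟨u, hu, rfl⟩, _, ⟨w, hw, rfl⟩, rfl⟩
    exact ⟨u + w, fun x => ⟨add_nonneg (hu x).1 (hw x).1, add_le_add (hu x).2 (hw x).2⟩, by simp⟩

theorem dualValues_smul (Λ : (X →ᵇ ℝ) →L[ℝ] ℝ) (f : X →ᵇ ℝ) {c : ℝ} (hc : 0 < c) :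
    dualValues Λ (c • f) = c • dualValues Λ f := by
  ext v
  constructor
  · rintro ⟨w, h, rfl⟩
    refine ⟨Λ (c⁻¹ • w), ⟨c⁻¹ • w, fun x => ⟨?_, ?_⟩, rfl⟩, ?_⟩
    · exact mul_nonneg (inv_nonneg.2 hc.le) (h x).1
    · have : w x ≤ c * f x := (h x).2
      change c⁻¹ * w x ≤ f x
      rwa [inv_mul_le_iff₀ hc]
    · simp only [map_smul, smul_eq_mul]; field_simp
  · rintro ⟨_, ⟨u, h, rfl⟩, rfl⟩
    exact ⟨c • u, fun x => ⟨mul_nonneg hc.le (h x).1, mul_le_mul_of_nonneg_left (h x).2 hc.le⟩,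
      by simp⟩

/-- The positive part of a bounded functional on bounded continuous functions. -/
noncomputable def dualPos (Λ : (X →ᵇ ℝ) →L[ℝ] ℝ) (f : X →ᵇ ℝ) : ℝ := sSup (dualValues Λ f)

theorem dualPos_nonneg (Λ : (X →ᵇ ℝ) →L[ℝ] ℝ) {f : X →ᵇ ℝ} (hf : ∀ x, 0 ≤ f x) :
    0 ≤ dualPos Λ f :=
  le_csSup (dualValues_bddAbove Λ f) (zero_mem_dualValues Λ hf)

theorem le_dualPos (Λ : (X →ᵇ ℝ) →L[ℝ] ℝ) {f : X →ᵇ ℝ} (hf : ∀ x, 0 ≤ f x) :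
    Λ f ≤ dualPos Λ f :=
  le_csSup (dualValues_bddAbove Λ f) ⟨f, fun x => ⟨hf x, le_rfl⟩, rfl⟩

theorem dualPos_le (Λ : (X →ᵇ ℝ) →L[ℝ] ℝ) {f : X →ᵇ ℝ} (hf : ∀ x, 0 ≤ f x) :
    dualPos Λ f ≤ ‖Λ‖ * ‖f‖ :=
  csSup_le ⟨0, zero_mem_dualValues Λ hf⟩ fun _ => dualValues_le

theorem dualPos_add (Λ : (X →ᵇ ℝ) →L[ℝ] ℝ) {f g : X →ᵇ ℝ} (hf : ∀ x, 0 ≤ f x)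
    (hg : ∀ x, 0 ≤ g x) : dualPos Λ (f + g) = dualPos Λ f + dualPos Λ g := by
  unfold dualPos
  rw [dualValues_add Λ hf hg, csSup_add ⟨0, zero_mem_dualValues Λ hf⟩ (dualValues_bddAbove Λ f)
    ⟨0, zero_mem_dualValues Λ hg⟩ (dualValues_bddAbove Λ g)]

theorem dualPos_smul (Λ : (X →ᵇ ℝ) →L[ℝ] ℝ) {f : X →ᵇ ℝ} (hf : ∀ x, 0 ≤ f x) {c : ℝ}
    (hc : 0 ≤ c) : dualPos Λ (c • f) = c * dualPos Λ f := by
  rcases hc.eq_or_lt with rfl | hc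
  · have h1 := dualPos_add Λ (f := (0 : ℝ) • f) (g := f) (fun x => by simp) hf
    rw [zero_smul, zero_add] at h1
    rw [zero_smul]
    linarith
  · unfold dualPos
    rw [dualValues_smul Λ f hc, Real.sSup_smul_of_nonneg hc.le, smul_eq_mul]

variable [T2Space X] [LocallyCompactSpace X] [MeasurableSpace X] [BorelSpace X]

theorem exists_isFiniteMeasure_of_positive (Φ : (X →ᵇ ℝ) → ℝ) (C : ℝ) (hC : 0 ≤ C)
    (hpos : ∀ f : X →ᵇ ℝ, (∀ x, 0 ≤ f x) → 0 ≤ Φ f)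
    (hle : ∀ f : X →ᵇ ℝ, (∀ x, 0 ≤ f x) → Φ f ≤ C * ‖f‖)
    (hadd : ∀ f g : X →ᵇ ℝ, (∀ x, 0 ≤ f x) → (∀ x, 0 ≤ g x) → Φ (f + g) = Φ f + Φ g)
    (hsmul : ∀ (c : ℝ) (f : X →ᵇ ℝ), 0 ≤ c → (∀ x, 0 ≤ f x) → Φ (c • f) = c * Φ f) :
    ∃ P : Measure X, IsFiniteMeasure P ∧
      ∀ f : C_c(X, ℝ≥0), ∫ x, (f x : ℝ) ∂P = Φ (toRealBCF f) := by
  have h0 : ∀ (f : C_c(X, ℝ≥0)) (x : X), 0 ≤ toRealBCF f x := fun f x => by simp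
  let Λ : C_c(X, ℝ≥0) →ₗ[ℝ≥0] ℝ≥0 :=
    { toFun := fun f => ⟨Φ (toRealBCF f), hpos _ (h0 f)⟩
      map_add' := fun f g => by
        apply NNReal.eq
        have : toRealBCF (f + g) = toRealBCF f + toRealBCF g := by ext x; simp
        change Φ (toRealBCF (f + g)) = Φ (toRealBCF f) + Φ (toRealBCF g)
        rw [this, hadd _ _ (h0 f) (h0 g)]
      map_smul' := fun c f => by
        apply NNReal.eq
        have : toRealBCF (c • f) = (c : ℝ) • toRealBCF f := by ext x; simp
        change Φ (toRealBCF (c • f)) = (c : ℝ) * Φ (toRealBCF f)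
        rw [this]
        exact hsmul c _ c.2 (h0 f) }
  refine ⟨NNRealRMK.rieszMeasure Λ, ?_, fun f => NNRealRMK.integral_rieszMeasure Λ f⟩
  constructor
  refine lt_of_le_of_lt ?_ (ENNReal.ofReal_lt_top (r := C))
  rw [isOpen_univ.measure_eq_iSup_isCompact]
  refine iSup₂_le fun K _ => iSup_le fun hK => ?_
  obtain ⟨f, hf1, -, hfc, hf01⟩ :=
    exists_continuous_one_zero_of_isCompact hK isClosed_empty (disjoint_empty K)
  let F : C_c(X, ℝ≥0) :=
    ⟨⟨fun x => (f x).toNNReal, by fun_prop⟩, hfc.comp_left Real.toNNReal_zero⟩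
  have hF : ∀ x, F x = (f x).toNNReal := fun x => rfl
  calc NNRealRMK.rieszMeasure Λ K = ∫⁻ x in K, 1 ∂(NNRealRMK.rieszMeasure Λ) := by simp
    _ = ∫⁻ x in K, F x ∂(NNRealRMK.rieszMeasure Λ) := by
      refine setLIntegral_congr_fun hK.measurableSet fun x hx => ?_
      simp [hF, hf1 hx]
    _ ≤ ∫⁻ x, F x ∂(NNRealRMK.rieszMeasure Λ) := setLIntegral_le_lintegral _ _
    _ = Λ F := NNRealRMK.lintegral_rieszMeasure Λ F
    _ ≤ ENNReal.ofReal C := by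
      rw [← ENNReal.ofReal_coe_nnreal]
      refine ENNReal.ofReal_le_ofReal ((hle _ (h0 F)).trans ?_)
      refine mul_le_of_le_one_right hC ?_
      refine (BoundedContinuousFunction.norm_le zero_le_one).2 fun x => ?_
      rw [toRealBCF_apply, hF, Real.coe_toNNReal _ (hf01 x).1, Real.norm_eq_abs,
        abs_of_nonneg (hf01 x).1]
      exact (hf01 x).2

theorem exists_measure_sub_of_continuousLinearMap (Λ : (X →ᵇ ℝ) →L[ℝ] ℝ) :
    ∃ P N : Measure X, IsFiniteMeasure P ∧ IsFiniteMeasure N ∧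
      ∀ f : X →ᵇ ℝ, HasCompactSupport f → ∫ x, f x ∂P - ∫ x, f x ∂N = Λ f := by
  obtain ⟨P, hP, hPi⟩ := exists_isFiniteMeasure_of_positive (dualPos Λ) ‖Λ‖ (norm_nonneg Λ)
    (fun f => dualPos_nonneg Λ) (fun f => dualPos_le Λ) (fun f g => dualPos_add Λ)
    (fun c f hc hf => dualPos_smul Λ hf hc)
  obtain ⟨N, hN, hNi⟩ := exists_isFiniteMeasure_of_positive (fun f => dualPos Λ f - Λ f)
    (2 * ‖Λ‖) (by positivity)
    (fun f hf => sub_nonneg.2 (le_dualPos Λ hf))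
    (fun f hf => by
      have h1 := dualPos_le Λ hf
      have h2 := (neg_abs_le (Λ f))
      have h3 := Λ.le_opNorm f
      rw [Real.norm_eq_abs] at h3
      linarith)
    (fun f g hf hg => by rw [dualPos_add Λ hf hg, map_add]; ring)
    (fun c f hc hf => by rw [dualPos_smul Λ hf hc, map_smul, smul_eq_mul]; ring)
  refine ⟨P, N, hP, hN, fun f hf => ?_⟩
  let f1 : C_c(X, ℝ≥0) := ⟨⟨fun x => (f x).toNNReal, by fun_prop⟩, hf.comp_left Real.toNNReal_zero⟩
  let f2 : C_c(X, ℝ≥0) := ⟨⟨fun x => (-f x).toNNReal, by fun_prop⟩,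
    hf.comp_left (g := fun t : ℝ => (-t).toNNReal) (by simp)⟩
  have e1 : ∀ x, f1 x = (f x).toNNReal := fun x => rfl
  have e2 : ∀ x, f2 x = (-f x).toNNReal := fun x => rfl
  have e : f = toRealBCF f1 - toRealBCF f2 := by
    ext x
    simp only [BoundedContinuousFunction.coe_sub, Pi.sub_apply, toRealBCF_apply, e1, e2,
      Real.coe_toNNReal']
    rcases le_total 0 (f x) with h | h
    · simp [h]
    · simp [h]
  have hint : ∀ (μ : Measure X) [IsFiniteMeasure μ], ∫ x, f x ∂μ =
      ∫ x, (f1 x : ℝ) ∂μ - ∫ x, (f2 x : ℝ) ∂μ := fun μ _ => by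
    rw [← integral_sub]
    · refine integral_congr_ae (Eventually.of_forall fun x => ?_)
      exact congrArg (fun g : X →ᵇ ℝ => g x) e
    · exact ((toRealBCF f1).continuous.integrable_of_hasCompactSupport
        (f1.hasCompactSupport.comp_left (g := ((↑) : ℝ≥0 → ℝ)) rfl))
    · exact ((toRealBCF f2).continuous.integrable_of_hasCompactSupport
        (f2.hasCompactSupport.comp_left (g := ((↑) : ℝ≥0 → ℝ)) rfl))
  rw [hint P, hint N, hPi, hPi, hNi, hNi]
  have := congrArg Λ e
  rw [map_sub] at this
  linarith

end RieszSigned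

section TestFunctions

open scoped BoundedContinuousFunction

variable {n : ℕ}

/-- The smooth compactly supported functions, inside the bounded continuous ones. -/
def testSubmodule (n : ℕ) : Submodule ℝ (RSpace n →ᵇ ℝ) where
  carrier := {g | ContDiff ℝ ∞ g ∧ HasCompactSupport g}
  add_mem' := fun hf hg => ⟨hf.1.add hg.1, hf.2.add hg.2⟩
  zero_mem' := ⟨contDiff_const, HasCompactSupport.zero⟩
  smul_mem' := fun c _ hf => ⟨contDiff_const.smul hf.1, hf.2.smul_left (f := fun _ => c)⟩

theorem IsTestFn.mono {Ω Ω' : Set (RSpace n)} {φ : RSpace n → ℝ} (hφ : IsTestFn Ω φ)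
    (h : Ω ⊆ Ω') : IsTestFn Ω' φ :=
  ⟨hφ.1, hφ.2.1, hφ.2.2.trans h⟩

/-- A functional on test functions bounded by the supremum norm is a signed measure. -/
theorem exists_signedMeasure_of_bounded (L : (RSpace n → ℝ) → ℝ) (C : ℝ)
    (hadd : ∀ φ ψ, IsTestFn univ φ → IsTestFn univ ψ → L (φ + ψ) = L φ + L ψ)
    (hsmul : ∀ (c : ℝ) φ, IsTestFn univ φ → L (c • φ) = c * L φ)
    (hb : ∀ φ, IsTestFn univ φ → ∀ B : ℝ, (∀ x, |φ x| ≤ B) → |L φ| ≤ C * B) :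
    ∃ μ : SignedMeasure (RSpace n), ∀ φ, IsTestFn univ φ → ∫ᵛ x, φ x ∂<•μ = L φ := by
  have ht : ∀ g : testSubmodule n, IsTestFn univ (g : RSpace n →ᵇ ℝ) := fun g =>
    ⟨g.2.1, g.2.2, subset_univ _⟩
  let F : testSubmodule n →ₗ[ℝ] ℝ :=
    { toFun := fun g => L (g : RSpace n →ᵇ ℝ)
      map_add' := fun f g => hadd _ _ (ht f) (ht g)
      map_smul' := fun c f => hsmul c _ (ht f) }
  obtain ⟨Λ, hΛ, -⟩ := exists_extension_norm_eq (testSubmodule n)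
    (F.mkContinuous C fun g => hb _ (ht g) _ fun x => (g : RSpace n →ᵇ ℝ).norm_coe_le_norm x)
  obtain ⟨P, N, hP, hN, h⟩ := exists_measure_sub_of_continuousLinearMap Λ
  refine ⟨P.toSignedMeasure - N.toSignedMeasure, fun φ hφ => ?_⟩
  have hi : ∀ (μ : Measure (RSpace n)) [IsFiniteMeasure μ],
      μ.toSignedMeasure.Integrable φ := fun μ _ => by
    rw [VectorMeasure.Integrable, Measure.variation_toSignedMeasure]
    exact hφ.1.continuous.integrable_of_hasCompactSupport hφ.2.1
  rw [VectorMeasure.integral_sub_vectorMeasure (hi P) (hi N)]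
  rw [VectorMeasure.integral_toSignedMeasure, VectorMeasure.integral_toSignedMeasure]
  let g : RSpace n →ᵇ ℝ := bcfOfCompact φ hφ.1.continuous hφ.2.1
  have hg : g ∈ testSubmodule n := ⟨hφ.1, hφ.2.1⟩
  have h1 := h g hφ.2.1
  have h2 : Λ g = L φ := hΛ ⟨g, hg⟩
  rw [← h2, ← h1]
  rfl

instance (μ : SignedMeasure (RSpace n)) : IsFiniteMeasure μ.variation := by
  rw [← SignedMeasure.totalVariation_eq_variation]
  infer_instance

/-- A signed measure whose integral vanishes on the test functions of an open set vanishes on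
this set. -/
theorem variation_eq_zero_of_forall_integral (μ : SignedMeasure (RSpace n)) {U : Set (RSpace n)}
    (hU : IsOpen U) (h : ∀ φ, IsTestFn U φ → ∫ᵛ x, φ x ∂<•μ = 0) : μ.variation U = 0 := by
  set P := μ.toJordanDecomposition.posPart
  set N := μ.toJordanDecomposition.negPart
  obtain ⟨i, hi, hPi, hNi⟩ := μ.toJordanDecomposition.mutuallySingular
  have hμ : μ = P.toSignedMeasure - N.toSignedMeasure :=
    (μ.toSignedMeasure_toJordanDecomposition).symm
  have hint : ∀ φ, IsTestFn U φ → ∫ x, φ x ∂P = ∫ x, φ x ∂N := fun φ hφ => by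
    have hI : ∀ (μ : Measure (RSpace n)) [IsFiniteMeasure μ],
        μ.toSignedMeasure.Integrable φ := fun μ _ => by
      rw [VectorMeasure.Integrable, Measure.variation_toSignedMeasure]
      exact hφ.1.continuous.integrable_of_hasCompactSupport hφ.2.1
    have h1 := h φ hφ
    rw [hμ, VectorMeasure.integral_sub_vectorMeasure (hI P) (hI N),
      VectorMeasure.integral_toSignedMeasure, VectorMeasure.integral_toSignedMeasure] at h1
    exact sub_eq_zero.1 h1
  classical
  let f : RSpace n → ℝ := fun x => if x ∈ i then -1 else 1
  have hf : Measurable f := Measurable.ite hi measurable_const measurable_const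
  have hfb : ∀ x, ‖f x‖ = 1 := fun x => by by_cases hx : x ∈ i <;> simp [f, hx]
  have hfP : f =ᵐ[P] fun _ => 1 := by
    filter_upwards [(measure_eq_zero_iff_ae_notMem.1 hPi)] with x hx
    simp [f, hx]
  have hfN : f =ᵐ[N] fun _ => -1 := by
    filter_upwards [(measure_eq_zero_iff_ae_notMem.1 hNi)] with x hx
    simp only [mem_compl_iff, not_not] at hx
    simp [f, hx]
  have key := hU.ae_eq_zero_of_integral_contDiff_smul_eq_zero (μ := P + N) (f := f)
    ((Integrable.of_bound hf.aestronglyMeasurable 1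
      (Eventually.of_forall fun x => (hfb x).le)).locallyIntegrable.locallyIntegrableOn U)
    (fun g hg hgc hgU => by
      have hgI : ∀ (μ : Measure (RSpace n)) [IsFiniteMeasure μ],
          Integrable (fun x => g x • f x) μ := fun μ _ =>
        (hg.continuous.integrable_of_hasCompactSupport hgc).mul_bdd (c := 1)
          hf.aestronglyMeasurable (Eventually.of_forall fun x => (hfb x).le)
      rw [integral_add_measure (hgI P) (hgI N)]
      have e1 : ∫ x, g x • f x ∂P = ∫ x, g x ∂P :=
        integral_congr_ae (by filter_upwards [hfP] with x hx; simp [hx])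
      have e2 : ∫ x, g x • f x ∂N = - ∫ x, g x ∂N := by
        rw [← integral_neg]
        exact integral_congr_ae (by filter_upwards [hfN] with x hx; simp [hx])
      rw [e1, e2, hint g ⟨hg, hgc, hgU⟩, add_neg_cancel])
  rw [← SignedMeasure.totalVariation_eq_variation]
  change (P + N) U = 0
  rw [measure_eq_zero_iff_ae_notMem]
  filter_upwards [key] with x hx hxU
  have := hfb x
  rw [hx hxU] at this
  simp at this

end TestFunctions

section CantorFunction

/-- The class of profiles rising from `0` to `1` on the unit interval. -/
structure IsRise (f : ℝ → ℝ) : Prop where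
  cont : Continuous f
  mono : Monotone f
  zero : ∀ x ≤ 0, f x = 0
  one : ∀ x, 1 ≤ x → f x = 1

/-- The self-similarity operator whose fixed point is the Cantor function. -/
noncomputable def riseStep (f : ℝ → ℝ) (x : ℝ) : ℝ := (f (3 * x) + f (3 * x - 2)) / 2

theorem IsRise.riseStep {f : ℝ → ℝ} (hf : IsRise f) : IsRise (riseStep f) where
  cont := by
    have := hf.cont
    unfold _root_.riseStep
    fun_prop
  mono := fun x y h => by
    unfold _root_.riseStep
    have h1 := hf.mono (show 3 * x ≤ 3 * y by linarith)
    have h2 := hf.mono (show 3 * x - 2 ≤ 3 * y - 2 by linarith)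
    linarith
  zero := fun x hx => by
    unfold _root_.riseStep
    rw [hf.zero _ (by linarith), hf.zero _ (by linarith)]; norm_num
  one := fun x hx => by
    unfold _root_.riseStep
    rw [hf.one _ (by linarith), hf.one _ (by linarith)]; norm_num

theorem isRise_clamp : IsRise fun x => max 0 (min x 1) where
  cont := by fun_prop
  mono := fun x y h => max_le_max le_rfl (min_le_min h le_rfl)
  zero := fun x hx => max_eq_left ((min_le_left _ _).trans hx)
  one := fun x hx => by simp [min_eq_right hx]

theorem abs_riseStep_sub_le {f g : ℝ → ℝ} (hf : IsRise f) (hg : IsRise g) {δ : ℝ}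
    (h : ∀ x, |f x - g x| ≤ δ) (x : ℝ) : |riseStep f x - riseStep g x| ≤ δ / 2 := by
  unfold riseStep
  rcases le_total 1 (3 * x) with hx | hx
  · rw [hf.one _ hx, hg.one _ hx]
    have := h (3 * x - 2)
    rw [show (1 + f (3 * x - 2)) / 2 - (1 + g (3 * x - 2)) / 2
      = (f (3 * x - 2) - g (3 * x - 2)) / 2 by ring, abs_div, abs_two]
    linarith
  · rw [hf.zero (3 * x - 2) (by linarith), hg.zero (3 * x - 2) (by linarith)]
    have := h (3 * x)
    rw [show (f (3 * x) + 0) / 2 - (g (3 * x) + 0) / 2 = (f (3 * x) - g (3 * x)) / 2 by ring,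
      abs_div, abs_two]
    linarith

theorem volume_eq_zero_of_selfSimilar {K : Set ℝ} (hK : K ⊆ Icc 0 1)
    (h : ∀ x ∈ K, 3 * x ∈ K ∨ 3 * x - 2 ∈ K) : volume K = 0 := by
  have hfin : volume K ≠ ⊤ := ((measure_mono hK).trans_lt (by simp)).ne
  have h1 : K ⊆ (fun x => 3 * x) ⁻¹' K ∪ (fun x => 3 * x) ⁻¹' ((fun x => x + (-2)) ⁻¹' K) :=
    fun x hx => h x hx
  have h2 : volume K ≤ ENNReal.ofReal (2 / 3) * volume K := by
    refine (measure_mono h1).trans ((measure_union_le _ _).trans ?_)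
    rw [Real.volume_preimage_mul_left (by norm_num), Real.volume_preimage_mul_left (by norm_num),
      measure_preimage_add_right, ← add_mul, ← ENNReal.ofReal_add (by positivity) (by positivity)]
    norm_num [abs_of_pos]
  by_contra h0
  have h3 : ENNReal.ofReal (2 / 3) * volume K < 1 * volume K := by
    refine (ENNReal.mul_lt_mul_iff_left h0 hfin).2 ?_
    rw [← ENNReal.ofReal_one]
    exact (ENNReal.ofReal_lt_ofReal_iff one_pos).2 (by norm_num)
  rw [one_mul] at h3
  exact absurd h2 (not_le.2 h3)

/-- The Cantor function: continuous, rising from `0` to `1`, locally constant almost everywhere. -/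
theorem exists_cantor_rise : ∃ c : ℝ → ℝ, IsRise c ∧ ∀ᵐ x, ∀ᶠ y in 𝓝 x, c y = c x := by
  let F : ℕ → ℝ → ℝ := fun k => riseStep^[k] fun x => max 0 (min x 1)
  have hF : ∀ k, IsRise (F k) := fun k => by
    induction k with
    | zero => exact isRise_clamp
    | succ k ih =>
      simp only [F, Function.iterate_succ_apply'] at ih ⊢
      exact ih.riseStep
  have hstep : ∀ k, F (k + 1) = riseStep (F k) := fun k => by
    simp only [F, Function.iterate_succ_apply']
  have h01 : ∀ {f : ℝ → ℝ}, IsRise f → ∀ x, 0 ≤ f x ∧ f x ≤ 1 := fun {f} hf x => by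
    constructor
    · rw [← hf.zero (min x 0) (min_le_right _ _)]; exact hf.mono (min_le_left _ _)
    · rw [← hf.one (max x 1) (le_max_right _ _)]; exact hf.mono (le_max_left _ _)
  have hd : ∀ k x, |F k x - F (k + 1) x| ≤ 2 / 2 / 2 ^ k := fun k => by
    induction k with
    | zero =>
      intro x
      have h1 := h01 (hF 0) x
      have h2 := h01 (hF 1) x
      rw [abs_le]; norm_num
      constructor <;> linarith
    | succ k ih =>
      intro x
      rw [hstep k, hstep (k + 1)]
      refine (abs_riseStep_sub_le (hF k) (hF (k + 1)) ih x).trans (le_of_eq ?_)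
      rw [pow_succ]; field_simp
  have hlim : ∀ x, ∃ l, Tendsto (fun k => F k x) atTop (𝓝 l) := fun x =>
    cauchySeq_tendsto_of_complete (cauchySeq_of_le_geometric_two fun k => by
      rw [Real.dist_eq]; exact hd k x)
  choose c hc using hlim
  have hunif : TendstoUniformly F c atTop := by
    rw [Metric.tendstoUniformly_iff]
    intro ε hε
    have : Tendsto (fun k : ℕ => (2 : ℝ) / 2 ^ k) atTop (𝓝 0) :=
      tendsto_const_nhds.div_atTop (tendsto_pow_atTop_atTop_of_one_lt one_lt_two)
    filter_upwards [(tendsto_order.1 this).2 ε hε] with k hk x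
    rw [dist_comm]
    refine lt_of_le_of_lt ?_ hk
    exact dist_le_of_le_geometric_two_of_tendsto (fun k => by
      rw [Real.dist_eq]; exact hd k x) (hc x) k
  have hrise : IsRise c :=
    { cont := hunif.continuous (Frequently.of_forall fun k => (hF k).cont)
      mono := fun x y h => le_of_tendsto_of_tendsto' (hc x) (hc y) fun k => (hF k).mono h
      zero := fun x hx => tendsto_nhds_unique (hc x)
        (tendsto_const_nhds.congr fun k => ((hF k).zero x hx).symm)
      one := fun x hx => tendsto_nhds_unique (hc x)
        (tendsto_const_nhds.congr fun k => ((hF k).one x hx).symm) }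
  have hself : ∀ x, c x = (c (3 * x) + c (3 * x - 2)) / 2 := fun x => by
    refine tendsto_nhds_unique ((tendsto_add_atTop_iff_nat 1).2 (hc x)) ?_
    refine (((hc (3 * x)).add (hc (3 * x - 2))).div_const 2).congr fun k => ?_
    rw [hstep]; rfl
  refine ⟨c, hrise, ?_⟩
  rw [ae_iff]
  refine volume_eq_zero_of_selfSimilar (fun x hx => ?_) fun x hx => ?_
  · by_contra hx'
    rw [mem_Icc, not_and_or, not_le, not_le] at hx'
    refine hx ?_
    rcases hx' with h | h
    · filter_upwards [Iio_mem_nhds h] with y hy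
      rw [hrise.zero y (le_of_lt hy), hrise.zero x h.le]
    · filter_upwards [Ioi_mem_nhds h] with y hy
      rw [hrise.one y (le_of_lt hy), hrise.one x h.le]
  · by_contra hx'
    simp only [mem_ofPred_eq, not_or, not_not] at hx hx'
    refine hx ?_
    have t1 : Tendsto (fun y : ℝ => 3 * y) (𝓝 x) (𝓝 (3 * x)) := by
      exact (continuous_const.mul continuous_id).tendsto x
    have t2 : Tendsto (fun y : ℝ => 3 * y - 2) (𝓝 x) (𝓝 (3 * x - 2)) := t1.sub_const 2
    filter_upwards [t1.eventually hx'.1, t2.eventually hx'.2] with y h1 h2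
    rw [hself y, hself x, h1, h2]

theorem IsRise.nonneg {f : ℝ → ℝ} (hf : IsRise f) (x : ℝ) : 0 ≤ f x := by
  rw [← hf.zero (min x 0) (min_le_right _ _)]; exact hf.mono (min_le_left _ _)

theorem IsRise.le_one {f : ℝ → ℝ} (hf : IsRise f) (x : ℝ) : f x ≤ 1 := by
  rw [← hf.one (max x 1) (le_max_right _ _)]; exact hf.mono (le_max_left _ _)

theorem IsRise.integral_abs_sub_le {f : ℝ → ℝ} (hf : IsRise f) {τ : ℝ} (hτ : 0 ≤ τ) :
    Integrable (fun t => |f (t - τ) - f t|) ∧ ∫ t, |f (t - τ) - f t| ≤ τ := by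
  have hc : Continuous fun t => |f (t - τ) - f t| := by
    have := hf.cont
    fun_prop
  have hz : ∀ t, t ∉ Ioc 0 (1 + τ) → |f (t - τ) - f t| = 0 := fun t ht => by
    rw [mem_Ioc, not_and_or, not_lt, not_le] at ht
    rcases ht with h | h
    · rw [hf.zero t h, hf.zero (t - τ) (by linarith)]; simp
    · rw [hf.one t (by linarith), hf.one (t - τ) (by linarith)]; simp
  have hI : Integrable (fun t => |f (t - τ) - f t|) := by
    have h1 : IntegrableOn (fun t => |f (t - τ) - f t|) (Ioc 0 (1 + τ)) :=
      (hc.integrableOn_Icc).mono_set Ioc_subset_Icc_self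
    exact h1.integrable_of_forall_notMem_eq_zero hz
  refine ⟨hI, ?_⟩
  rw [← setIntegral_eq_integral_of_forall_compl_eq_zero hz,
    ← intervalIntegral.integral_of_le (by linarith)]
  have e1 : ∫ t in (0)..(1 + τ), |f (t - τ) - f t| = ∫ t in (0)..(1 + τ), (f t - f (t - τ)) := by
    refine intervalIntegral.integral_congr fun t _ => ?_
    have := hf.mono (show t - τ ≤ t by linarith)
    change |f (t - τ) - f t| = f t - f (t - τ)
    rw [abs_of_nonpos (by linarith)]; ring
  have ii : ∀ a b, IntervalIntegrable f volume a b := fun a b => hf.cont.intervalIntegrable a b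
  have hc2 : Continuous fun t => f (t - τ) := by
    have := hf.cont
    fun_prop
  rw [e1, intervalIntegral.integral_sub (ii _ _) (hc2.intervalIntegrable _ _),
    intervalIntegral.integral_comp_sub_right]
  have e2 : ∫ t in (0 - τ)..(1 + τ - τ), f t = ∫ t in (0)..1, f t := by
    rw [← intervalIntegral.integral_add_adjacent_intervals (ii (0 - τ) 0) (ii 0 (1 + τ - τ)),
      show 1 + τ - τ = 1 by ring]
    have : ∫ t in (0 - τ)..0, f t = ∫ t in (0 - τ)..0, (0 : ℝ) := by
      refine intervalIntegral.integral_congr fun t ht => ?_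
      rw [uIcc_of_le (by linarith)] at ht
      exact hf.zero t ht.2
    rw [this]; simp
  have e3 : ∫ t in (1)..(1 + τ), f t = τ := by
    have : ∫ t in (1)..(1 + τ), f t = ∫ t in (1)..(1 + τ), (1 : ℝ) := by
      refine intervalIntegral.integral_congr fun t ht => ?_
      rw [uIcc_of_le (by linarith)] at ht
      exact hf.one t ht.1
    rw [this]; simp
  rw [e2, ← intervalIntegral.integral_add_adjacent_intervals (ii 0 1) (ii 1 (1 + τ)), e3]
  linarith

theorem ae_comp_affine {P : ℝ → Prop} (hP : ∀ᵐ x, P x) {a : ℝ} (ha : a ≠ 0) (b : ℝ) :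
    ∀ᵐ x, P (a * x + b) := by
  rw [ae_iff] at hP ⊢
  change volume ((fun x => a * x) ⁻¹' ((fun x => x + b) ⁻¹' {x | ¬P x})) = 0
  rw [Real.volume_preimage_mul_left ha, measure_preimage_add_right, hP, mul_zero]

/-- A Cantor-type cutoff function on the interval of centre `c` and radius `r`. -/
theorem exists_cantor_hat (c : ℝ) {r : ℝ} (hr : 0 < r) : ∃ χ : ℝ → ℝ, Continuous χ ∧
    (∀ t, 0 ≤ χ t ∧ χ t ≤ 1) ∧ (∀ t, r ≤ |t - c| → χ t = 0) ∧ (∀ t, |t - c| ≤ r / 2 → χ t = 1) ∧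
    (∀ᵐ t, ∀ᶠ s in 𝓝 t, χ s = χ t) ∧
    ∀ τ, 0 ≤ τ → Integrable (fun t => |χ (t - τ) - χ t|) ∧ ∫ t, |χ (t - τ) - χ t| ≤ 2 * τ := by
  obtain ⟨f, hf, hloc⟩ := exists_cantor_rise
  have hfc := hf.cont
  set a : ℝ := 2 / r with ha
  have ha0 : 0 < a := by positivity
  have har : a * r = 2 := by rw [ha]; field_simp
  let b₁ : ℝ := 2 - a * c
  let b₂ : ℝ := -1 - a * c
  have hd : ∀ t, a * t + b₁ = a * (t - c) + 2 ∧ a * t + b₂ = a * (t - c) - 1 := fun t => by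
    constructor <;> simp only [b₁, b₂] <;> ring
  have hscale : ∀ b τ : ℝ, 0 ≤ τ →
      Integrable (fun t => |f (a * (t - τ) + b) - f (a * t + b)|) ∧
      ∫ t, |f (a * (t - τ) + b) - f (a * t + b)| ≤ τ := fun b τ hτ => by
    obtain ⟨h1, h2⟩ := hf.integral_abs_sub_le (τ := a * τ) (by positivity)
    have e : (fun t => |f (a * (t - τ) + b) - f (a * t + b)|) =
        fun t => (fun u => (fun s => |f (s - a * τ) - f s|) (u + b)) (a * t) := by
      ext t
      simp only
      rw [show a * (t - τ) + b = a * t + b - a * τ by ring]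
    rw [e]
    refine ⟨(h1.comp_add_right b).comp_mul_left' ha0.ne', ?_⟩
    rw [Measure.integral_comp_mul_left (fun u => (fun s => |f (s - a * τ) - f s|) (u + b)) a,
      integral_add_right_eq_self (fun s => |f (s - a * τ) - f s|) b, abs_of_pos (by positivity),
      smul_eq_mul, inv_mul_le_iff₀ ha0]
    exact h2
  refine ⟨fun t => f (a * t + b₁) - f (a * t + b₂), by fun_prop, fun t => ?_, fun t ht => ?_,
    fun t ht => ?_, ?_, fun τ hτ => ?_⟩
  · have h1 := hf.mono (show a * t + b₂ ≤ a * t + b₁ by rw [(hd t).1, (hd t).2]; linarith)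
    have h2 := hf.nonneg (a * t + b₂)
    have h3 := hf.le_one (a * t + b₁)
    constructor <;> linarith
  · beta_reduce
    rw [(hd t).1, (hd t).2]
    rcases le_abs.1 ht with h | h
    · have : 2 ≤ a * (t - c) := by rw [← har]; gcongr
      rw [hf.one _ (by linarith), hf.one _ (by linarith), sub_self]
    · have : 2 ≤ a * -(t - c) := by rw [← har]; gcongr
      rw [hf.zero _ (by linarith), hf.zero _ (by linarith), sub_self]
  · beta_reduce
    rw [(hd t).1, (hd t).2]
    have h1 : |a * (t - c)| ≤ 1 := by
      rw [abs_mul, abs_of_pos ha0]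
      calc a * |t - c| ≤ a * (r / 2) := by gcongr
        _ = 1 := by rw [mul_div_assoc', har]; norm_num
    rw [abs_le] at h1
    rw [hf.one _ (by linarith), hf.zero _ (by linarith), sub_zero]
  · have hcont : ∀ b : ℝ, Continuous fun t : ℝ => a * t + b := fun b => by fun_prop
    filter_upwards [ae_comp_affine hloc ha0.ne' b₁, ae_comp_affine hloc ha0.ne' b₂] with t h1 h2
    filter_upwards [((hcont b₁).tendsto t).eventually h1, ((hcont b₂).tendsto t).eventually h2]
      with s h3 h4
    rw [h3, h4]
  · obtain ⟨i1, h1⟩ := hscale b₁ τ hτ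
    obtain ⟨i2, h2⟩ := hscale b₂ τ hτ
    have hle : ∀ t, |f (a * (t - τ) + b₁) - f (a * (t - τ) + b₂)
        - (f (a * t + b₁) - f (a * t + b₂))| ≤
        |f (a * (t - τ) + b₁) - f (a * t + b₁)| + |f (a * (t - τ) + b₂) - f (a * t + b₂)| :=
      fun t => by
        refine le_trans (le_of_eq ?_) (abs_sub _ _)
        congr 1; ring
    have hI := (i1.add i2).mono' (f := fun t => |f (a * (t - τ) + b₁) - f (a * (t - τ) + b₂)
        - (f (a * t + b₁) - f (a * t + b₂))|)
      (Continuous.aestronglyMeasurable (by fun_prop)) (Eventually.of_forall fun t => by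
        simpa using hle t)
    refine ⟨hI, (integral_mono hI (i1.add i2) hle).trans ?_⟩
    rw [integral_add' i1 i2]
    linarith

end CantorFunction

section Sawtooth

theorem abs_sub_round_sub_le (x y : ℝ) : |x - round x| - |y - round y| ≤ |x - y| := by
  have h1 := round_le x (round y)
  have h2 := abs_sub_le x y (round y)
  linarith

theorem abs_sub_round_neg (x : ℝ) : |-x - round (-x)| = |x - round x| := by
  have h : ∀ x : ℝ, |-x - round (-x)| ≤ |x - round x| := fun x => by
    refine (round_le (-x) (-round x)).trans (le_of_eq ?_)
    push_cast
    rw [← abs_neg]; congr 1; ring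
  refine le_antisymm (h x) ?_
  simpa using h (-x)

theorem round_eq_of_abs_sub_lt {x : ℝ} {m : ℤ} (h : |x - m| < 1 / 2) : round x = m := by
  have h1 := (round_le x m).trans_lt h
  rw [abs_lt] at h h1
  have h2 : (round x : ℝ) < m + 1 := by linarith
  have h3 : (m : ℝ) < round x + 1 := by linarith
  exact le_antisymm (Int.lt_add_one_iff.1 (by exact_mod_cast h2))
    (Int.lt_add_one_iff.1 (by exact_mod_cast h3))

theorem exists_abs_sub_round_affine {x : ℝ} (hx : ∀ k : ℤ, 2 * x ≠ k) :
    ∃ σ : ℝ, (σ = 1 ∨ σ = -1) ∧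
      ∀ᶠ y : ℝ in 𝓝 x, |y - round y| = |x - round x| + σ * (y - x) := by
  set m := round x with hm
  have h1 : |x - m| < 1 / 2 := by
    refine lt_of_le_of_ne (abs_sub_round x) fun h => ?_
    rcases abs_eq (by norm_num : (0 : ℝ) ≤ 1 / 2) |>.1 h with h | h
    · exact hx (2 * m + 1) (by push_cast; linarith)
    · exact hx (2 * m - 1) (by push_cast; linarith)
  have h2 : x - m ≠ 0 := fun h => hx (2 * m) (by push_cast; linarith)
  have e1 : ∀ᶠ y : ℝ in 𝓝 x, |y - m| < 1 / 2 :=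
    (show Continuous fun y : ℝ => |y - m| by fun_prop).tendsto x |>.eventually (gt_mem_nhds h1)
  rcases lt_or_gt_of_ne h2 with h | h
  · refine ⟨-1, Or.inr rfl, ?_⟩
    filter_upwards [e1, gt_mem_nhds (show x < m by linarith)] with y hy hy2
    rw [round_eq_of_abs_sub_lt hy, abs_of_neg h, abs_of_neg (by linarith)]; ring
  · refine ⟨1, Or.inl rfl, ?_⟩
    filter_upwards [e1, lt_mem_nhds (show (m : ℝ) < x by linarith)] with y hy hy2
    rw [round_eq_of_abs_sub_lt hy, abs_of_pos h, abs_of_pos (by linarith)]; ring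

/-- A fine sawtooth on the interval of centre `0` and radius `r`. -/
theorem exists_sawtooth_zero {r ε : ℝ} (hr : 0 < r) (hε : 0 < ε) : ∃ h : ℝ → ℝ,
    LipschitzWith 1 h ∧ (∀ t, |h t| ≤ ε) ∧ (∀ t, r ≤ |t| → h t = 0) ∧ (∀ t, h (-t) = h t) ∧
    ∀ᵐ t, ∃ σ : ℝ, (|t| < r → σ = 1 ∨ σ = -1) ∧ ∀ᶠ s in 𝓝 t, h s = h t + σ * (s - t) := by
  obtain ⟨N, hN⟩ := exists_nat_gt (r / ε)
  have hN0 : (0 : ℝ) < N := lt_of_le_of_lt (by positivity) hN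
  set d : ℝ := r / N with hd
  have hd0 : 0 < d := by positivity
  have hdε : d ≤ ε := by
    rw [hd, div_le_iff₀ hN0]; rw [div_lt_iff₀ hε] at hN; linarith
  have hrd : r / d = N := by rw [hd]; field_simp
  let s : ℝ → ℝ := fun t => d * |t / d - round (t / d)|
  have hs0 : ∀ t, 0 ≤ s t := fun t => by positivity
  have hslip : ∀ t u, s t - s u ≤ |t - u| := fun t u => by
    have h1 := abs_sub_round_sub_le (t / d) (u / d)
    rw [← sub_div, abs_div, abs_of_pos hd0, le_div_iff₀ hd0] at h1
    simp only [s]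
    linarith
  have hsr : ∀ t, |t| ≤ r → s t ≤ r - |t| := fun t ht => by
    have key : ∀ z : ℤ, s t ≤ |t - d * z| := fun z => by
      have h1 := round_le (t / d) z
      have h2 : |t - d * z| = d * |t / d - z| := by
        rw [← abs_of_pos hd0, ← abs_mul, abs_of_pos hd0]; congr 1; field_simp
      rw [h2]
      exact mul_le_mul_of_nonneg_left h1 hd0.le
    have hdN : d * N = r := by rw [hd]; field_simp
    rcases le_total 0 t with h | h
    · have := key N
      rw [abs_of_nonneg h] at ht ⊢
      push_cast at this
      rwa [hdN, abs_of_nonpos (by linarith), neg_sub] at this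
    · have := key (-N)
      rw [abs_of_nonpos h] at ht ⊢
      push_cast at this
      rw [mul_neg, hdN, abs_of_nonneg (by linarith)] at this
      linarith
  let h : ℝ → ℝ := fun t => min (s t) (max 0 (r - |t|))
  have hin : ∀ t, |t| ≤ r → h t = s t := fun t ht =>
    min_eq_left ((hsr t ht).trans (le_max_right _ _))
  have hout : ∀ t, r ≤ |t| → h t = 0 := fun t ht => by
    simp only [h]
    rw [max_eq_left (by linarith), min_eq_right (hs0 t)]
  refine ⟨h, ?_, fun t => ?_, hout, fun t => ?_, ?_⟩
  · have l1 : LipschitzWith 1 s := LipschitzWith.of_le_add fun x y => by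
      have := hslip x y
      rw [Real.dist_eq]; linarith
    have l2 : LipschitzWith 1 fun t : ℝ => max 0 (r - |t|) := by
      refine LipschitzWith.const_max (LipschitzWith.of_le_add fun x y => ?_) 0
      have := abs_abs_sub_abs_le_abs_sub x y
      have := neg_abs_le (|x| - |y|)
      rw [Real.dist_eq]; linarith
    simpa using l1.min l2
  · rw [abs_of_nonneg (le_min (hs0 t) (le_max_left _ _))]
    refine (min_le_left _ _).trans (le_trans ?_ hdε)
    have := abs_sub_round (t / d)
    simp only [s]
    nlinarith
  · simp only [h, s, abs_neg, neg_div, abs_sub_round_neg]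
  · have hcount : (⋃ k : ℤ, {t : ℝ | 2 * (t / d) = k}).Countable := by
      refine countable_iUnion fun k => Set.Subsingleton.countable fun x hx y hy => ?_
      simp only [mem_ofPred_eq] at hx hy
      have : x / d = y / d := by linarith
      field_simp at this
      exact this
    filter_upwards [hcount.ae_notMem volume] with t ht
    simp only [mem_iUnion, mem_ofPred_eq, not_exists] at ht
    rcases lt_trichotomy |t| r with h1 | h1 | h1
    · obtain ⟨σ, hσ, hev⟩ := exists_abs_sub_round_affine ht
      refine ⟨σ, fun _ => hσ, ?_⟩
      have c1 : Tendsto (fun s : ℝ => s / d) (𝓝 t) (𝓝 (t / d)) :=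
        (show Continuous fun s : ℝ => s / d by fun_prop).tendsto t
      filter_upwards [c1.eventually hev,
        (continuous_abs.tendsto t).eventually (gt_mem_nhds h1)] with u hu hur
      rw [hin u hur.le, hin t h1.le]
      simp only [s]
      rw [hu]
      field_simp
    · exfalso
      rcases abs_eq hr.le |>.1 h1 with h | h
      · exact ht (2 * N) (by rw [h, hrd]; push_cast; ring)
      · exact ht (-(2 * N)) (by rw [h, neg_div, hrd]; push_cast; ring)
    · refine ⟨0, fun h => absurd h (not_lt.2 h1.le), ?_⟩
      filter_upwards [(continuous_abs.tendsto t).eventually (lt_mem_nhds h1)] with u hu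
      rw [hout u (le_of_lt hu), hout t h1.le]; ring

theorem eventually_deriv_eq {h : ℝ → ℝ} {t σ : ℝ}
    (ht : ∀ᶠ s in 𝓝 t, h s = h t + σ * (s - t)) : ∀ᶠ s in 𝓝 t, deriv h s = σ := by
  filter_upwards [ht.eventually_nhds] with s hs
  have e : h =ᶠ[𝓝 s] fun u => h t + σ * (u - t) := hs
  rw [e.deriv_eq]
  have : HasDerivAt (fun u => h t + σ * (u - t)) (σ * 1) s :=
    (((hasDerivAt_id s).sub_const t).const_mul σ).const_add (h t)
  rw [this.deriv, mul_one]

/-- A fine sawtooth on the interval of centre `c` and radius `r`, with its derivative. -/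
theorem exists_sawtooth (c : ℝ) {r ε : ℝ} (hr : 0 < r) (hε : 0 < ε) : ∃ h p : ℝ → ℝ,
    LipschitzWith 1 h ∧ Measurable p ∧ (∀ t, |h t| ≤ ε) ∧ (∀ t, |p t| ≤ 1) ∧
    (∀ t, r ≤ |t - c| → h t = 0) ∧ (∀ t, r < |t - c| → p t = 0) ∧
    (∀ᵐ t, ∀ᶠ s in 𝓝 t, p s = p t ∧ h s = h t + p t * (s - t)) ∧
    volume {t | |t - c| ≤ r ∧ p t = -1} = ENNReal.ofReal r := by
  obtain ⟨h, hl, hb, hz, heven, hae⟩ := exists_sawtooth_zero hr hε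
  have hpz : ∀ t, r < |t| → deriv h t = 0 := fun t ht => by
    refine (eventually_deriv_eq (σ := 0) ?_).self_of_nhds
    filter_upwards [(continuous_abs.tendsto t).eventually (lt_mem_nhds ht)] with u hu
    rw [hz u (le_of_lt hu), hz t ht.le]; ring
  have hodd : ∀ t, deriv h (-t) = - deriv h t := fun t => by
    have h1 := deriv_comp_neg h t
    rw [show (fun x => h (-x)) = h from funext heven] at h1
    rw [h1, neg_neg]
  have hT : ∀ t, Tendsto (fun s => s - c) (𝓝 t) (𝓝 (t - c)) := fun t =>
    (show Continuous fun s : ℝ => s - c by fun_prop).tendsto t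
  have haec : ∀ {P : ℝ → Prop}, (∀ᵐ x, P x) → ∀ᵐ x, P (x - c) := fun {P} hP =>
    (measurePreserving_sub_right volume c).quasiMeasurePreserving.ae hP
  have hm : Measurable (deriv h) := measurable_deriv h
  refine ⟨fun t => h (t - c), fun t => deriv h (t - c), ?_, hm.comp (by fun_prop),
    fun t => hb _, fun t => ?_, fun t => hz _, fun t => hpz _, ?_, ?_⟩
  · refine LipschitzWith.of_le_add fun x y => ?_
    have := hl.dist_le_mul (x - c) (y - c)
    rw [Real.dist_eq, Real.dist_eq] at this
    have h3 := le_abs_self (h (x - c) - h (y - c))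
    rw [Real.dist_eq]
    simp only [NNReal.coe_one, one_mul, sub_sub_sub_cancel_right] at this
    linarith
  · have := norm_deriv_le_of_lipschitz (x₀ := t - c) hl
    simpa using this
  · filter_upwards [haec hae] with t ht
    obtain ⟨σ, -, hσ⟩ := ht
    have hd := eventually_deriv_eq hσ
    filter_upwards [(hT t).eventually hd, (hT t).eventually hσ] with s h1 h2
    rw [hd.self_of_nhds, h1, h2]
    exact ⟨rfl, by ring⟩
  · let A : ℝ → Set ℝ := fun σ => {t | |t| ≤ r ∧ deriv h t = σ}
    have hA : ∀ σ, MeasurableSet (A σ) := fun σ =>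
      (measurableSet_le measurable_id.abs measurable_const).inter
        (hm (measurableSet_singleton σ))
    have e1 : {t | |t - c| ≤ r ∧ deriv h (t - c) = -1} = (fun t => t - c) ⁻¹' A (-1) := rfl
    rw [e1, (measurePreserving_sub_right volume c).measure_preimage (hA _).nullMeasurableSet]
    have e2 : volume (A 1) = volume (A (-1)) := by
      have : A 1 = (fun t => -t) ⁻¹' A (-1) := by
        ext t
        simp only [A, mem_preimage, mem_ofPred_eq, abs_neg, hodd, neg_inj]
      rw [this, (Measure.measurePreserving_neg volume).measure_preimage (hA _).nullMeasurableSet]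
    have e3 : volume (A 1 ∪ A (-1)) = ENNReal.ofReal (2 * r) := by
      have : volume (A 1 ∪ A (-1)) = volume (Icc (-r) r) := by
        refine measure_congr ?_
        have hne : ∀ᵐ t : ℝ, t ∉ ({r, -r} : Set ℝ) :=
          (Set.toFinite ({r, -r} : Set ℝ)).countable.ae_notMem volume
        filter_upwards [hae, hne] with t h1 hne'
        obtain ⟨σ, hσ, hev⟩ := h1
        refine propext ?_
        change t ∈ A 1 ∪ A (-1) ↔ t ∈ Icc (-r) r
        rw [mem_Icc, ← abs_le]
        constructor
        · rintro (h | h) <;> exact h.1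
        · intro h
          have hlt : |t| < r := lt_of_le_of_ne h fun h' => hne' (by
            rcases abs_eq hr.le |>.1 h' with h'' | h'' <;> simp [h''])
          have hd := (eventually_deriv_eq hev).self_of_nhds
          rcases hσ hlt with rfl | rfl
          · exact Or.inl ⟨h, hd⟩
          · exact Or.inr ⟨h, hd⟩
      rw [this, Real.volume_Icc]; congr 1; ring
    have hdisj : Disjoint (A 1) (A (-1)) := by
      rw [Set.disjoint_left]
      rintro t ⟨-, h1⟩ ⟨-, h2⟩
      rw [h1] at h2
      norm_num at h2
    rw [measure_union hdisj (hA _), e2, ENNReal.ofReal_mul (by norm_num), ← two_mul] at e3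
    have h2 : ENNReal.ofReal 2 = 2 := by norm_num
    rw [h2] at e3
    exact (ENNReal.mul_right_inj (by norm_num) (by norm_num)).1 e3

end Sawtooth

section WeakDerivative

variable {n : ℕ}

theorem IsTestFn.integrable {Ω : Set (RSpace n)} {φ : RSpace n → ℝ} (hφ : IsTestFn Ω φ) :
    Integrable φ :=
  hφ.1.continuous.integrable_of_hasCompactSupport hφ.2.1

theorem IsTestFn.continuous_partialDeriv {Ω : Set (RSpace n)} {φ : RSpace n → ℝ}
    (hφ : IsTestFn Ω φ) (j : Fin n) : Continuous (partialDeriv j φ) :=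
  (hφ.1.continuous_fderiv (by simp)).clm_apply continuous_const

theorem IsTestFn.hasCompactSupport_partialDeriv {Ω : Set (RSpace n)} {φ : RSpace n → ℝ}
    (hφ : IsTestFn Ω φ) (j : Fin n) : HasCompactSupport (partialDeriv j φ) :=
  hφ.2.1.fderiv_apply ℝ _

theorem IsTestFn.integrable_partialDeriv {Ω : Set (RSpace n)} {φ : RSpace n → ℝ}
    (hφ : IsTestFn Ω φ) (j : Fin n) : Integrable (partialDeriv j φ) :=
  (hφ.continuous_partialDeriv j).integrable_of_hasCompactSupport (hφ.hasCompactSupport_partialDeriv j)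

theorem tendsto_integral_differenceQuotient {Ψ φ : RSpace n → ℝ} (hΨ : Integrable Ψ)
    (hφ : IsTestFn univ φ) (j : Fin n) (hΨc : Continuous Ψ) :
    Tendsto (fun t : ℝ => ∫ y, t⁻¹ * (Ψ (y - t • EuclideanSpace.single j 1) - Ψ y) * φ y) (𝓝[>] 0)
      (𝓝 (∫ y, Ψ y * partialDeriv j φ y)) := by
  obtain ⟨D, hD⟩ := ContDiff.lipschitzWith_of_hasCompactSupport hφ.2.1 hφ.1 (by simp)
  have h := LipschitzWith.integral_inv_smul_sub_mul_tendsto_integral_lineDeriv_mul hD hΨ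
    (EuclideanSpace.single j (1 : ℝ))
  have e : ∀ y, lineDeriv ℝ φ y (EuclideanSpace.single j (1 : ℝ)) * Ψ y
      = Ψ y * partialDeriv j φ y := fun y => by
    rw [((hφ.1.differentiable (by simp)).differentiableAt).lineDeriv_eq_fderiv, mul_comm]
    rfl
  simp only [e] at h
  refine h.congr fun t => ?_
  set v := t • EuclideanSpace.single j (1 : ℝ) with hv
  have i1 : Integrable fun y => Ψ y * φ (y + v) :=
    (hΨc.mul (hφ.1.continuous.comp (continuous_id.add continuous_const)))
      |>.integrable_of_hasCompactSupport ((hφ.2.1.comp_homeomorph (Homeomorph.addRight v)).mul_left)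
  have i2 : Integrable fun y => Ψ y * φ y :=
    (hΨc.mul hφ.1.continuous).integrable_of_hasCompactSupport hφ.2.1.mul_left
  have i3 : Integrable fun y => Ψ (y - v) * φ y :=
    ((hΨc.comp (continuous_id.sub continuous_const)).mul hφ.1.continuous)
      |>.integrable_of_hasCompactSupport hφ.2.1.mul_left
  have e1 : ∫ y, Ψ (y - v) * φ y = ∫ y, Ψ y * φ (y + v) := by
    rw [← integral_add_right_eq_self (fun y => Ψ (y - v) * φ y) v]
    simp
  calc ∫ y, t⁻¹ • (φ (y + v) - φ y) * Ψ y
      = t⁻¹ * ((∫ y, Ψ y * φ (y + v)) - ∫ y, Ψ y * φ y) := by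
        rw [← integral_sub i1 i2, ← integral_const_mul]
        congr 1; ext y; rw [smul_eq_mul]; ring
    _ = ∫ y, t⁻¹ * (Ψ (y - v) - Ψ y) * φ y := by
        rw [← e1, ← integral_sub i3 i2, ← integral_const_mul]
        congr 1; ext y; ring

theorem abs_integral_mul_partialDeriv_le {Ψ : RSpace n → ℝ} (hΨ : Integrable Ψ)
    (hΨc : Continuous Ψ) (j : Fin n) {C : ℝ}
    (hC : ∀ t : ℝ, 0 < t → ∫ y, |Ψ (y - t • EuclideanSpace.single j 1) - Ψ y| ≤ C * t)
    {φ : RSpace n → ℝ} (hφ : IsTestFn univ φ) {B : ℝ} (hB : ∀ x, |φ x| ≤ B) :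
    |∫ y, Ψ y * partialDeriv j φ y| ≤ C * B := by
  refine le_of_tendsto (tendsto_integral_differenceQuotient hΨ hφ j hΨc).abs ?_
  filter_upwards [self_mem_nhdsWithin] with t (ht : 0 < t)
  set v := t • EuclideanSpace.single j (1 : ℝ) with hv
  have hB0 : 0 ≤ B := (abs_nonneg _).trans (hB 0)
  have iΨ : Integrable fun y => |Ψ (y - v) - Ψ y| := ((hΨ.comp_sub_right v).sub hΨ).abs
  calc |∫ y, t⁻¹ * (Ψ (y - v) - Ψ y) * φ y| ≤ ∫ y, (t⁻¹ * B) * |Ψ (y - v) - Ψ y| := by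
        rw [← Real.norm_eq_abs]
        refine norm_integral_le_of_norm_le (iΨ.const_mul _) (Eventually.of_forall fun y => ?_)
        rw [Real.norm_eq_abs, abs_mul, abs_mul, abs_of_pos (inv_pos.2 ht)]
        have := hB y
        calc t⁻¹ * |Ψ (y - v) - Ψ y| * |φ y| ≤ t⁻¹ * |Ψ (y - v) - Ψ y| * B := by gcongr
          _ = _ := by ring
    _ = (t⁻¹ * B) * ∫ y, |Ψ (y - v) - Ψ y| := integral_const_mul _ _
    _ ≤ (t⁻¹ * B) * (C * t) := by gcongr; exact hC t ht
    _ = C * B := by field_simp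

theorem integral_mul_partialDeriv_eq_neg {Ψ π : RSpace n → ℝ} (hΨ : Integrable Ψ)
    (hΨc : Continuous Ψ) (j : Fin n)
    (hlip : ∀ (t : ℝ) y, 0 < t → |Ψ (y - t • EuclideanSpace.single j 1) - Ψ y| ≤ t)
    (hloc : ∀ᵐ x, ∀ᶠ y in 𝓝 x, Ψ y = Ψ x + π x * (y j - x j))
    {φ : RSpace n → ℝ} (hφ : IsTestFn univ φ) :
    ∫ y, Ψ y * partialDeriv j φ y = - ∫ y, π y * φ y := by
  refine tendsto_nhds_unique (tendsto_integral_differenceQuotient hΨ hφ j hΨc) ?_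
  rw [← integral_neg]
  have hmeas : ∀ t : ℝ, Continuous fun y =>
      t⁻¹ * (Ψ (y - t • EuclideanSpace.single j 1) - Ψ y) * φ y := fun t => by
    have := hφ.1.continuous
    fun_prop
  refine tendsto_integral_filter_of_dominated_convergence (fun y => |φ y|)
    (Eventually.of_forall fun t => (hmeas t).aestronglyMeasurable) ?_ hφ.integrable.abs ?_
  · filter_upwards [self_mem_nhdsWithin] with t (ht : 0 < t)
    refine Eventually.of_forall fun y => ?_
    rw [Real.norm_eq_abs, abs_mul, abs_mul, abs_of_pos (inv_pos.2 ht)]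
    refine mul_le_of_le_one_left (abs_nonneg _) ?_
    rw [inv_mul_le_iff₀ ht, mul_one]
    exact hlip t y ht
  · filter_upwards [hloc] with x hx
    have hT : Tendsto (fun t : ℝ => x - t • EuclideanSpace.single j (1 : ℝ)) (𝓝[>] 0) (𝓝 x) := by
      have : Continuous fun t : ℝ => x - t • EuclideanSpace.single j (1 : ℝ) := by fun_prop
      have h := this.tendsto 0
      rw [zero_smul, sub_zero] at h
      exact h.mono_left nhdsWithin_le_nhds
    refine tendsto_const_nhds.congr' ?_
    filter_upwards [hT.eventually hx, self_mem_nhdsWithin] with t h1 (ht : 0 < t)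
    rw [h1, show (x - t • EuclideanSpace.single j (1 : ℝ)) j - x j = -t by simp]
    field_simp
    ring

end WeakDerivative

section Cube

variable {n : ℕ}

/-- The closed cube of centre `c` and half side `r`. -/
def cube (c : RSpace n) (r : ℝ) : Set (RSpace n) := {y | ∀ i, |y i - c i| ≤ r}

theorem isClosed_cube (c : RSpace n) (r : ℝ) : IsClosed (cube c r) := by
  have : cube c r = ⋂ i, {y | |y i - c i| ≤ r} := by ext; simp [cube]
  rw [this]
  exact isClosed_iInter fun i => isClosed_le (by fun_prop) continuous_const

theorem volume_box (s : Fin n → Set ℝ) :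
    volume {y : RSpace n | ∀ i, y i ∈ s i} = ∏ i, volume (s i) := by
  rw [← volume_pi_pi, ← (EuclideanSpace.volume_preserving_symm_measurableEquiv_toLp
    (Fin n)).measure_preimage_equiv]
  congr 1
  ext y
  simp

theorem volume_cube (c : RSpace n) {r : ℝ} (hr : 0 ≤ r) :
    volume (cube c r) = ENNReal.ofReal ((2 * r) ^ n) := by
  have : cube c r = {y | ∀ i, y i ∈ Icc (c i - r) (c i + r)} := by
    ext y
    simp only [cube, mem_ofPred_eq, mem_Icc, abs_le]
    exact forall_congr' fun i => ⟨fun h => ⟨by linarith [h.1], by linarith [h.2]⟩,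
      fun h => ⟨by linarith [h.1], by linarith [h.2]⟩⟩
  rw [this, volume_box]
  simp only [Real.volume_Icc]
  rw [Finset.prod_congr rfl fun i _ => by rw [show c i + r - (c i - r) = 2 * r by ring],
    Finset.prod_const, Finset.card_univ, Fintype.card_fin, ENNReal.ofReal_pow (by positivity)]

theorem cube_subset_closedBall (c : RSpace n) {r : ℝ} (hr : 0 ≤ r) :
    cube c r ⊆ Metric.closedBall c (√n * r) := fun y hy => by
  rw [Metric.mem_closedBall, EuclideanSpace.dist_eq]
  refine Real.sqrt_le_iff.2 ⟨by positivity, ?_⟩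
  rw [mul_pow, Real.sq_sqrt (by positivity)]
  calc ∑ i, dist (y i) (c i) ^ 2 ≤ ∑ _i : Fin n, r ^ 2 :=
        Finset.sum_le_sum fun i _ => by
          rw [Real.dist_eq]
          exact pow_le_pow_left₀ (abs_nonneg _) (hy i) 2
    _ = n * r ^ 2 := by simp

theorem isCompact_cube (c : RSpace n) {r : ℝ} (hr : 0 ≤ r) : IsCompact (cube c r) :=
  (isCompact_closedBall c _).of_isClosed_subset (isClosed_cube c r) (cube_subset_closedBall c hr)

theorem ae_coord {P : ℝ → Prop} (hP : ∀ᵐ t, P t) (i : Fin n) : ∀ᵐ y : RSpace n, P (y i) :=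
  ((Measure.quasiMeasurePreserving_eval (fun _ : Fin n => (volume : Measure ℝ)) i).comp
    (PiLp.volume_preserving_ofLp (Fin n)).quasiMeasurePreserving).ae hP

theorem integral_prod_coord (F : Fin n → ℝ → ℝ) (hF : ∀ i, Integrable (F i)) :
    Integrable (fun y : RSpace n => ∏ i, F i (y i)) ∧
      ∫ y : RSpace n, ∏ i, F i (y i) = ∏ i, ∫ t, F i t := by
  have hp := EuclideanSpace.volume_preserving_symm_measurableEquiv_toLp (Fin n)
  have h1 : Integrable (fun x : Fin n → ℝ => ∏ i, F i (x i)) := Integrable.fintype_prod hF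
  constructor
  · exact (hp.integrable_comp_emb (MeasurableEquiv.measurableEmbedding _)).2 h1
  · rw [← integral_fintype_prod_volume_eq_prod]
    exact hp.integral_comp' (fun x : Fin n → ℝ => ∏ i, F i (x i))

/-- A fine sawtooth in the direction `j`, cut off to a cube by Cantor functions in the other
directions: its derivative in the direction `j` is a bounded function `π`, which is `-1` on a fixed
fraction of the cube, and its other derivatives are small measures. -/
theorem exists_profile (j : Fin n) (c : RSpace n) {r ε : ℝ} (hr : 0 < r) (hε : 0 < ε) :
    ∃ Ψ π : RSpace n → ℝ, Continuous Ψ ∧ Measurable π ∧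
      (∀ y, y ∉ cube c r → Ψ y = 0 ∧ π y = 0) ∧ (∀ y, |Ψ y| ≤ ε) ∧ (∀ y, |π y| ≤ 1) ∧
      (∀ᵐ x, ∀ᶠ y in 𝓝 x, π y = π x ∧ Ψ y = Ψ x + π x * (y j - x j)) ∧
      (∀ φ, IsTestFn univ φ → ∫ y, Ψ y * partialDeriv j φ y = - ∫ y, π y * φ y) ∧
      (∀ i, i ≠ j → ∀ φ, IsTestFn univ φ → ∀ B, (∀ x, |φ x| ≤ B) →
        |∫ y, Ψ y * partialDeriv i φ y| ≤ ε * B) ∧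
      volume (cube c r) ≤ 2 ^ n * volume {y | π y = -1} := by
  set M : ℝ := 2 * (2 * r) ^ (n - 1) + 1 with hM
  have hM1 : 1 ≤ M := by
    have : 0 ≤ 2 * (2 * r) ^ (n - 1) := by positivity
    linarith
  set δ : ℝ := ε / M with hδ
  have hδ0 : 0 < δ := by positivity
  have hδε : δ ≤ ε := div_le_self hε.le hM1
  choose χ hχc hχ01 hχ0 hχ1 hχloc hχτ using fun i : Fin n => exists_cantor_hat (c i) hr
  obtain ⟨h, p, hl, hpm, hhb, hpb, hh0, hp0, hhloc, hvol⟩ := exists_sawtooth (c j) hr hδ0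
  have hhc := hl.continuous
  let X : RSpace n → ℝ := fun y => ∏ i ∈ Finset.univ.erase j, χ i (y i)
  have hX0 : ∀ y, 0 ≤ X y := fun y => Finset.prod_nonneg fun i _ => (hχ01 i _).1
  have hX1 : ∀ y, X y ≤ 1 := fun y =>
    Finset.prod_le_one (fun i _ => (hχ01 i _).1) fun i _ => (hχ01 i _).2
  have hXc : Continuous X := continuous_finsetProd _ fun i _ => (hχc i).comp (by fun_prop)
  have hXz : ∀ y i, i ≠ j → r ≤ |y i - c i| → X y = 0 := fun y i hij hi =>
    Finset.prod_eq_zero (Finset.mem_erase.2 ⟨hij, Finset.mem_univ i⟩) (hχ0 i _ hi)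
  let Ψ : RSpace n → ℝ := fun y => h (y j) * X y
  let π : RSpace n → ℝ := fun y => p (y j) * X y
  have hΨc : Continuous Ψ := (hhc.comp (by fun_prop)).mul hXc
  have hout : ∀ y, y ∉ cube c r → Ψ y = 0 ∧ π y = 0 := fun y hy => by
    simp only [cube, mem_ofPred_eq, not_forall, not_le] at hy
    obtain ⟨i, hi⟩ := hy
    by_cases hij : i = j
    · subst hij
      simp [Ψ, π, hh0 _ hi.le, hp0 _ hi]
    · simp [Ψ, π, hXz y i hij hi.le]
  have hΨs : HasCompactSupport Ψ := HasCompactSupport.intro (isCompact_cube c hr.le)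
    fun y hy => (hout y hy).1
  have hΨi : Integrable Ψ := hΨc.integrable_of_hasCompactSupport hΨs
  have hloc : ∀ᵐ x : RSpace n, ∀ᶠ y in 𝓝 x, π y = π x ∧ Ψ y = Ψ x + π x * (y j - x j) := by
    have hco : ∀ (x : RSpace n) (i : Fin n), Tendsto (fun y : RSpace n => y i) (𝓝 x) (𝓝 (x i)) :=
      fun x i => (show Continuous fun y : RSpace n => y i by fun_prop).tendsto x
    have h1 : ∀ᵐ x : RSpace n, ∀ i, ∀ᶠ s in 𝓝 (x i), χ i s = χ i (x i) :=
      ae_all_iff.2 fun i => ae_coord (hχloc i) i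
    filter_upwards [h1, ae_coord hhloc j] with x hx hxj
    filter_upwards [eventually_all.2 fun i => (hco x i).eventually (hx i),
      (hco x j).eventually hxj] with y hy hyj
    have hXy : X y = X x := Finset.prod_congr rfl fun i _ => hy i
    simp only [Ψ, π, hXy, hyj.1, hyj.2, true_and]
    ring
  refine ⟨Ψ, π, hΨc, (hpm.comp (by fun_prop)).mul hXc.measurable, hout, fun y => ?_, fun y => ?_,
    hloc, fun φ hφ => ?_, fun i hij φ hφ B hB => ?_, ?_⟩
  · rw [abs_mul, abs_of_nonneg (hX0 y)]
    exact (mul_le_of_le_one_right (abs_nonneg _) (hX1 y)).trans ((hhb _).trans hδε)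
  · rw [abs_mul, abs_of_nonneg (hX0 y)]
    exact (mul_le_of_le_one_right (abs_nonneg _) (hX1 y)).trans (hpb _)
  · refine integral_mul_partialDeriv_eq_neg hΨi hΨc j (fun t y ht => ?_)
      (hloc.mono fun x hx => hx.mono fun y hy => hy.2) hφ
    have hXy : X (y - t • EuclideanSpace.single j 1) = X y :=
      Finset.prod_congr rfl fun i hi => by simp [Finset.ne_of_mem_erase hi]
    simp only [Ψ, hXy]
    rw [← sub_mul, abs_mul, abs_of_nonneg (hX0 y)]
    refine (mul_le_of_le_one_right (abs_nonneg _) (hX1 y)).trans ?_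
    have := hl.dist_le_mul ((y - t • EuclideanSpace.single j (1 : ℝ)) j) (y j)
    rw [Real.dist_eq, Real.dist_eq] at this
    refine this.trans (le_of_eq ?_)
    simp [abs_of_pos ht]
  · refine abs_integral_mul_partialDeriv_le hΨi hΨc i (fun t ht => ?_) hφ hB
    let D : Fin n → ℝ → ℝ := fun k s => if k = i then |χ i (s - t) - χ i s|
      else (Icc (c k - r) (c k + r)).indicator 1 s
    have hDne : ∀ k, k ≠ i → D k = (Icc (c k - r) (c k + r)).indicator 1 := fun k hk => by
      ext s; simp [D, hk]
    have hDi : D i = fun s => |χ i (s - t) - χ i s| := by ext s; simp [D]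
    have hD0 : ∀ k s, 0 ≤ D k s := fun k s => by
      by_cases hk : k = i
      · subst hk; rw [hDi]; positivity
      · rw [hDne k hk]; exact indicator_nonneg (fun _ _ => zero_le_one) s
    have hD1 : ∀ k, k ≠ i → ∀ s, |s - c k| ≤ r → D k s = 1 := fun k hk s hs => by
      rw [hDne k hk, indicator_of_mem]; · rfl
      rw [abs_le] at hs
      exact ⟨by linarith, by linarith⟩
    have hχD : ∀ k, k ≠ i → ∀ s, χ k s ≤ D k s := fun k hk s => by
      rcases le_total r |s - c k| with hs | hs
      · rw [hχ0 k s hs]; exact hD0 k s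
      · rw [hD1 k hk s hs]; exact (hχ01 k s).2
    have hhD : ∀ s, |h s| ≤ δ * D j s := fun s => by
      rcases le_total r |s - c j| with hs | hs
      · rw [hh0 s hs, abs_zero]; exact mul_nonneg hδ0.le (hD0 j s)
      · rw [hD1 j (Ne.symm hij) s hs, mul_one]; exact hhb s
    have hDint : ∀ k, Integrable (D k) := fun k => by
      by_cases hk : k = i
      · subst hk; rw [hDi]; exact (hχτ k t ht.le).1
      · rw [hDne k hk]
        exact (integrable_indicator_iff measurableSet_Icc).2 (integrableOn_const (by simp))
    obtain ⟨hPi, hPe⟩ := integral_prod_coord D hDint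
    have hmem : i ∈ Finset.univ.erase j := Finset.mem_erase.2 ⟨hij, Finset.mem_univ i⟩
    have hpt : ∀ y : RSpace n, |Ψ (y - t • EuclideanSpace.single i 1) - Ψ y| ≤
        δ * ∏ k, D k (y k) := fun y => by
      let Y : RSpace n → ℝ := fun y => ∏ k ∈ (Finset.univ.erase j).erase i, χ k (y k)
      have hXY : ∀ z, X z = χ i (z i) * Y z := fun z => (Finset.mul_prod_erase _ _ hmem).symm
      have hYs : Y (y - t • EuclideanSpace.single i 1) = Y y :=
        Finset.prod_congr rfl fun k hk => by simp [Finset.ne_of_mem_erase hk]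
      have hY0 : 0 ≤ Y y := Finset.prod_nonneg fun k _ => (hχ01 k _).1
      have hYD : Y y ≤ ∏ k ∈ (Finset.univ.erase j).erase i, D k (y k) :=
        Finset.prod_le_prod (fun k _ => (hχ01 k _).1)
          fun k hk => hχD k (Finset.ne_of_mem_erase hk) _
      rw [← Finset.mul_prod_erase Finset.univ _ (Finset.mem_univ j),
        ← Finset.mul_prod_erase _ _ hmem]
      simp only [Ψ, hXY, hYs]
      have e : h ((y - t • EuclideanSpace.single i (1 : ℝ)) j) *
          (χ i ((y - t • EuclideanSpace.single i (1 : ℝ)) i) * Y y) - h (y j) * (χ i (y i) * Y y)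
          = h (y j) * (χ i (y i - t) - χ i (y i)) * Y y := by
        have : (y - t • EuclideanSpace.single i (1 : ℝ)) j = y j := by simp [Ne.symm hij]
        rw [this]
        simp
        ring
      rw [e, abs_mul, abs_mul, abs_of_nonneg hY0]
      have hDi' : |χ i (y i - t) - χ i (y i)| = D i (y i) := by rw [hDi]
      rw [hDi']
      calc |h (y j)| * D i (y i) * Y y
          ≤ (δ * D j (y j)) * D i (y i) * ∏ k ∈ (Finset.univ.erase j).erase i, D k (y k) := by
            gcongr
            · exact mul_nonneg (mul_nonneg hδ0.le (hD0 _ _)) (hD0 _ _)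
            · exact hD0 _ _
            · exact hhD _
        _ = _ := by ring
    have hprod : ∏ k, ∫ s, D k s ≤ 2 * t * (2 * r) ^ (n - 1) := by
      rw [← Finset.mul_prod_erase Finset.univ _ (Finset.mem_univ i)]
      have e1 : ∏ k ∈ Finset.univ.erase i, ∫ s, D k s = (2 * r) ^ (n - 1) := by
        rw [Finset.prod_congr rfl fun k hk => ?_, Finset.prod_const,
          Finset.card_erase_of_mem (Finset.mem_univ i), Finset.card_univ, Fintype.card_fin]
        rw [hDne k (Finset.ne_of_mem_erase hk), integral_indicator_one measurableSet_Icc,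
          Real.volume_real_Icc, max_eq_left (by linarith)]
        ring
      rw [e1, hDi]
      gcongr
      exact (hχτ i t ht.le).2
    calc ∫ y, |Ψ (y - t • EuclideanSpace.single i 1) - Ψ y| ≤ ∫ y : RSpace n, δ * ∏ k, D k (y k) :=
          integral_mono ((hΨi.comp_sub_right _).sub hΨi).abs (hPi.const_mul δ) hpt
      _ = δ * ∏ k, ∫ s, D k s := by rw [integral_const_mul, hPe]
      _ ≤ δ * (2 * t * (2 * r) ^ (n - 1)) := by gcongr
      _ ≤ δ * (M * t) := by
          refine mul_le_mul_of_nonneg_left ?_ hδ0.le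
          rw [hM]; linarith
      _ = ε * t := by rw [hδ]; field_simp
  · let s : Fin n → Set ℝ := fun i => if i = j then {t | |t - c j| ≤ r ∧ p t = -1}
      else Icc (c i - r / 2) (c i + r / 2)
    have hs : ∀ i, volume (s i) = ENNReal.ofReal r := fun i => by
      by_cases hi : i = j
      · simp only [s, hi, if_true]; exact hvol
      · simp only [s, hi, if_false]
        rw [Real.volume_Icc]; congr 1; ring
    have hsub : {y : RSpace n | ∀ i, y i ∈ s i} ⊆ {y | π y = -1} := fun y hy => by
      have h1 : p (y j) = -1 := by
        have := hy j
        simp only [s, if_true] at this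
        exact this.2
      have h2 : X y = 1 := Finset.prod_eq_one fun i hi => hχ1 i _ (by
        have := hy i
        simp only [s, Finset.ne_of_mem_erase hi, if_false, mem_Icc] at this
        rw [abs_le]
        exact ⟨by linarith [this.1], by linarith [this.2]⟩)
      change p (y j) * X y = -1
      rw [h1, h2, mul_one]
    calc volume (cube c r) = 2 ^ n * volume {y : RSpace n | ∀ i, y i ∈ s i} := by
          rw [volume_cube c hr.le, volume_box, Finset.prod_congr rfl fun i _ => hs i,
            Finset.prod_const, Finset.card_univ, Fintype.card_fin, mul_pow,
            ENNReal.ofReal_mul (by positivity), ENNReal.ofReal_pow (by norm_num),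
            ENNReal.ofReal_pow hr.le]
          norm_num
      _ ≤ _ := by gcongr

end Cube

section Stage

variable {n : ℕ}

theorem integral_eq_zero_of_weakDeriv {Ψ π : RSpace n → ℝ} {j : Fin n} {c : RSpace n} {r : ℝ}
    (hr : 0 < r) (hz : ∀ y, y ∉ cube c r → Ψ y = 0 ∧ π y = 0)
    (h : ∀ φ, IsTestFn univ φ → ∫ y, Ψ y * partialDeriv j φ y = - ∫ y, π y * φ y) :
    ∫ y, π y = 0 := by
  have hR : 0 < √n * r + 1 := by positivity
  let φ : ContDiffBump c := ⟨√n * r + 1, √n * r + 2, hR, by linarith⟩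
  have hφ : IsTestFn univ φ := ⟨φ.contDiff, φ.hasCompactSupport, subset_univ _⟩
  have hin : ∀ y ∈ cube c r, y ∈ Metric.ball c (√n * r + 1) := fun y hy => by
    have := cube_subset_closedBall c hr.le hy
    rw [Metric.mem_closedBall] at this
    rw [Metric.mem_ball]; linarith
  have h1 : ∀ y ∈ cube c r, φ y = 1 := fun y hy =>
    φ.one_of_mem_closedBall (Metric.ball_subset_closedBall (hin y hy))
  have h2 : ∀ y ∈ cube c r, partialDeriv j φ y = 0 := fun y hy => by
    have e : (φ : RSpace n → ℝ) =ᶠ[𝓝 y] fun _ => 1 := by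
      filter_upwards [Metric.isOpen_ball.mem_nhds (hin y hy)] with z hz
      exact φ.one_of_mem_closedBall (Metric.ball_subset_closedBall hz)
    unfold partialDeriv
    rw [e.fderiv_eq]
    simp
  have h3 := h φ hφ
  have e1 : ∀ y, Ψ y * partialDeriv j φ y = 0 := fun y => by
    by_cases hy : y ∈ cube c r
    · rw [h2 y hy, mul_zero]
    · rw [(hz y hy).1, zero_mul]
  have e2 : ∀ y, π y * φ y = π y := fun y => by
    by_cases hy : y ∈ cube c r
    · rw [h1 y hy, mul_one]
    · rw [(hz y hy).2, zero_mul]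
  simp only [e1, e2, integral_zero] at h3
  linarith

/-- Near `x`, `a` and `b` are constant, `f` is affine with gradient `a e_q` and `g` is affine with
gradient `b e_p`. -/
def LocAffAt (p q : Fin n) (f g a b : RSpace n → ℝ) (x : RSpace n) : Prop :=
  ∀ᶠ y in 𝓝 x, a y = a x ∧ b y = b x ∧ f y = f x + a x * (y q - x q) ∧
    g y = g x + b x * (y p - x p)

/-- An intermediate displacement `f e_p + g e_q`, with `a = ∂_q f` and `b = ∂_p g` locally constant
almost everywhere, and with the other derivatives of `f` and `g` controlled as measures. -/
structure IsStage (K : Set (RSpace n)) (p q : Fin n) (f g a b : RSpace n → ℝ) (C : ℝ) : Prop where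
  cont_f : Continuous f
  cont_g : Continuous g
  meas_a : Measurable a
  meas_b : Measurable b
  bdd : ∃ B, ∀ x, |a x| ≤ B ∧ |b x| ≤ B
  off : ∀ x, x ∉ K → f x = 0 ∧ g x = 0 ∧ a x = 0 ∧ b x = 0
  loc : ∀ᵐ x, LocAffAt p q f g a b x
  weak_f : ∀ φ, IsTestFn univ φ → ∫ y, f y * partialDeriv q φ y = - ∫ y, a y * φ y
  weak_g : ∀ φ, IsTestFn univ φ → ∫ y, g y * partialDeriv p φ y = - ∫ y, b y * φ y
  small_f : ∀ j, j ≠ q → ∀ φ, IsTestFn univ φ → ∀ B, (∀ x, |φ x| ≤ B) →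
    |∫ y, f y * partialDeriv j φ y| ≤ C * B
  small_g : ∀ j, j ≠ p → ∀ φ, IsTestFn univ φ → ∀ B, (∀ x, |φ x| ≤ B) →
    |∫ y, g y * partialDeriv j φ y| ≤ C * B

variable {K : Set (RSpace n)} {p q : Fin n} {f g a b : RSpace n → ℝ} {C : ℝ}

theorem LocAffAt.swap {x : RSpace n} (h : LocAffAt p q f g a b x) : LocAffAt q p g f b a x :=
  h.mono fun _ hy => ⟨hy.2.1, hy.1, hy.2.2.2, hy.2.2.1⟩

theorem IsStage.swap (h : IsStage K p q f g a b C) : IsStage K q p g f b a C where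
  cont_f := h.cont_g
  cont_g := h.cont_f
  meas_a := h.meas_b
  meas_b := h.meas_a
  bdd := let ⟨B, hB⟩ := h.bdd; ⟨B, fun x => (hB x).symm⟩
  off := fun x hx => let ⟨h1, h2, h3, h4⟩ := h.off x hx; ⟨h2, h1, h4, h3⟩
  loc := h.loc.mono fun _ hx => hx.swap
  weak_f := h.weak_g
  weak_g := h.weak_f
  small_f := h.small_g
  small_g := h.small_f

theorem IsStage.mono (h : IsStage K p q f g a b C) {C' : ℝ} (hC : C ≤ C') :
    IsStage K p q f g a b C' :=
  { h with
    small_f := fun j hj φ hφ D hD => (h.small_f j hj φ hφ D hD).trans (by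
      have : 0 ≤ D := (abs_nonneg _).trans (hD 0)
      gcongr)
    small_g := fun j hj φ hφ D hD => (h.small_g j hj φ hφ D hD).trans (by
      have : 0 ≤ D := (abs_nonneg _).trans (hD 0)
      gcongr) }

theorem isStage_zero (K : Set (RSpace n)) (p q : Fin n) :
    IsStage K p q (fun _ => 0) (fun _ => 0) (fun _ => 0) (fun _ => 0) 0 where
  cont_f := continuous_const
  cont_g := continuous_const
  meas_a := measurable_const
  meas_b := measurable_const
  bdd := ⟨0, by simp⟩
  off := by simp
  loc := by simp [LocAffAt]
  weak_f := by simp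
  weak_g := by simp
  small_f := by simp
  small_g := by simp

theorem integrable_mul_of_continuous_off (hK : IsCompact K) {f : RSpace n → ℝ} (hf : Continuous f)
    (h0 : ∀ x, x ∉ K → f x = 0) {ψ : RSpace n → ℝ} (hψ : Continuous ψ) :
    Integrable fun y => f y * ψ y :=
  (hf.mul hψ).integrable_of_hasCompactSupport
    (HasCompactSupport.intro hK fun y hy => by rw [Pi.mul_apply, h0 y hy, zero_mul])

theorem integrable_of_bdd_off (hK : IsCompact K) {a : RSpace n → ℝ} (ha : Measurable a) {B : ℝ}
    (hB : ∀ x, |a x| ≤ B) (h0 : ∀ x, x ∉ K → a x = 0) : Integrable a := by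
  have h1 : IntegrableOn a K := by
    have : IsFiniteMeasure (volume.restrict K) := ⟨by simpa using hK.measure_lt_top⟩
    exact Integrable.of_bound ha.aestronglyMeasurable B (Eventually.of_forall hB)
  exact h1.integrable_of_forall_notMem_eq_zero h0

theorem IsStage.integrable_a (h : IsStage K p q f g a b C) (hK : IsCompact K) : Integrable a := by
  obtain ⟨B, hB⟩ := h.bdd
  exact integrable_of_bdd_off hK h.meas_a (fun x => (hB x).1) fun x hx => (h.off x hx).2.2.1

theorem IsStage.add_profile (h : IsStage K p q f g a b C) (hK : IsCompact K) {c : RSpace n}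
    {r ε : ℝ} (hcK : cube c r ⊆ K) {Ψ π : RSpace n → ℝ} (hΨc : Continuous Ψ) (hπm : Measurable π)
    (hz : ∀ y, y ∉ cube c r → Ψ y = 0 ∧ π y = 0) (hπ1 : ∀ y, |π y| ≤ 1)
    (hloc : ∀ᵐ x, ∀ᶠ y in 𝓝 x, π y = π x ∧ Ψ y = Ψ x + π x * (y q - x q))
    (hw : ∀ φ, IsTestFn univ φ → ∫ y, Ψ y * partialDeriv q φ y = - ∫ y, π y * φ y)
    (hs : ∀ i, i ≠ q → ∀ φ, IsTestFn univ φ → ∀ B, (∀ x, |φ x| ≤ B) →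
        |∫ y, Ψ y * partialDeriv i φ y| ≤ ε * B) (σ : ℝ) (hε : 0 ≤ ε) :
    IsStage K p q (fun x => f x + σ * Ψ x) g (fun x => a x + σ * π x) b (C + |σ| * ε) := by
  have hzK : ∀ y, y ∉ K → Ψ y = 0 ∧ π y = 0 := fun y hy => hz y fun hc => hy (hcK hc)
  have hi : ∀ (j : Fin n) φ, IsTestFn univ φ → ∫ y, (f y + σ * Ψ y) * partialDeriv j φ y =
      (∫ y, f y * partialDeriv j φ y) + σ * ∫ y, Ψ y * partialDeriv j φ y := fun j φ hφ => by
    rw [← integral_const_mul, ← integral_add]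
    · congr 1; ext y; ring
    · exact integrable_mul_of_continuous_off hK h.cont_f (fun x hx => (h.off x hx).1)
        (hφ.continuous_partialDeriv j)
    · exact (integrable_mul_of_continuous_off hK hΨc (fun x hx => (hzK x hx).1)
        (hφ.continuous_partialDeriv j)).const_mul σ
  obtain ⟨B, hB⟩ := h.bdd
  exact
  { cont_f := h.cont_f.add (continuous_const.mul hΨc)
    cont_g := h.cont_g
    meas_a := h.meas_a.add (measurable_const.mul hπm)
    meas_b := h.meas_b
    bdd := by
      refine ⟨B + |σ|, fun x => ⟨(abs_add_le _ _).trans ?_, ?_⟩⟩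
      · rw [abs_mul]
        exact add_le_add (hB x).1 (mul_le_of_le_one_right (abs_nonneg _) (hπ1 x))
      · linarith [(hB x).2, abs_nonneg σ]
    off := fun x hx => by
      obtain ⟨h1, h2, h3, h4⟩ := h.off x hx
      obtain ⟨h5, h6⟩ := hzK x hx
      simp [*]
    loc := by
      filter_upwards [h.loc, hloc] with x h1 h2
      filter_upwards [h1, h2] with y h3 h4
      refine ⟨by rw [h3.1, h4.1], h3.2.1, ?_, h3.2.2.2⟩
      rw [h3.2.2.1, h4.2]; ring
    weak_f := fun φ hφ => by
      rw [hi q φ hφ, h.weak_f φ hφ, hw φ hφ]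
      have i1 : Integrable fun y => a y * φ y :=
        hφ.integrable.bdd_mul (c := B) h.meas_a.aestronglyMeasurable
          (Eventually.of_forall fun x => (hB x).1)
      have i2 : Integrable fun y => σ * (π y * φ y) :=
        (hφ.integrable.bdd_mul (c := 1) hπm.aestronglyMeasurable
          (Eventually.of_forall hπ1)).const_mul σ
      have e : ∀ y, (a y + σ * π y) * φ y = a y * φ y + σ * (π y * φ y) := fun y => by ring
      simp only [e]
      rw [integral_add i1 i2, integral_const_mul]
      ring
    weak_g := h.weak_g
    small_f := fun j hj φ hφ D hD => by
      rw [hi j φ hφ]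
      refine (abs_add_le _ _).trans ?_
      rw [abs_mul, add_mul]
      have := mul_le_mul_of_nonneg_left (hs j hj φ hφ D hD) (abs_nonneg σ)
      rw [← mul_assoc] at this
      exact add_le_add (h.small_f j hj φ hφ D hD) this
    small_g := (h.mono (le_add_of_nonneg_right (by positivity))).small_g }

/-- The relation between a stage and a refinement of it. -/
structure IsRefinement (K : Set (RSpace n)) (p q : Fin n) (f g a b : RSpace n → ℝ) (C ε : ℝ)
    (f' g' a' b' : RSpace n → ℝ) : Prop where
  stage : IsStage K p q f' g' a' b' (C + ε)
  close : ∀ x, |f' x - f x| ≤ ε ∧ |g' x - g x| ≤ ε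
  mass : ∫ x, |a' x + b' x| = ∫ x, |a x + b x|

theorem IsStage.exists_refinement_cube_aux (h : IsStage K p q f g a b C) (hK : IsCompact K)
    {c : RSpace n} {r ε a₀ b₀ : ℝ} (hr : 0 < r) (hε : 0 < ε) (hcK : cube c r ⊆ K)
    (hab : ∀ y ∈ cube c r, a y = a₀ ∧ b y = b₀) (hle : |a₀| ≤ |b₀|) :
    ∃ f' g' a' b', IsRefinement K p q f g a b C ε f' g' a' b' ∧
      (∀ x, x ∉ cube c r → f' x = f x ∧ g' x = g x ∧ a' x = a x ∧ b' x = b x) ∧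
      volume (cube c r) ≤
        2 ^ n * volume {x | x ∈ cube c r ∧ a' x + b' x = 0 ∧ |a₀ + b₀| / 2 ≤ |a' x|} := by
  set σ := a₀ + b₀ with hσ
  set δ := ε / (|σ| + 1) with hδ
  have hδ0 : 0 < δ := by positivity
  have hσδ : |σ| * δ ≤ ε := by
    rw [hδ, mul_div_assoc', div_le_iff₀ (by positivity)]
    nlinarith [abs_nonneg σ]
  obtain ⟨Ψ, π, hΨc, hπm, hz, hΨb, hπ1, hloc, hw, hs, hvol⟩ := exists_profile q c hr hδ0
  have hst := h.add_profile hK hcK hΨc hπm hz hπ1 hloc hw hs σ hδ0.le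
  refine ⟨fun x => f x + σ * Ψ x, g, fun x => a x + σ * π x, b,
    ⟨hst.mono (by linarith), fun x => ⟨?_, ?_⟩, ?_⟩, fun x hx => ?_, hvol.trans ?_⟩
  · rw [add_sub_cancel_left, abs_mul]
    exact (mul_le_mul_of_nonneg_left (hΨb x) (abs_nonneg σ)).trans hσδ
  · simpa using hε.le
  · have e : ∀ x, |a x + σ * π x + b x| = |a x + b x| + |σ| * π x := fun x => by
      by_cases hx : x ∈ cube c r
      · obtain ⟨h1, h2⟩ := hab x hx
        have := (abs_le.1 (hπ1 x)).1
        rw [h1, h2, show a₀ + σ * π x + b₀ = σ * (1 + π x) by rw [hσ]; ring, abs_mul,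
          abs_of_nonneg (show 0 ≤ 1 + π x by linarith)]
        ring
      · rw [(hz x hx).2]; simp
    simp only [e]
    have i1 : Integrable fun x => |a x + b x| :=
      ((h.integrable_a hK).add (h.swap.integrable_a hK)).abs
    have i2 : Integrable fun x => |σ| * π x :=
      (integrable_of_bdd_off hK hπm hπ1 fun x hx => (hz x fun hc => hx (hcK hc)).2).const_mul _
    rw [integral_add i1 i2, integral_const_mul, integral_eq_zero_of_weakDeriv hr hz hw]
    simp
  · obtain ⟨h1, h2⟩ := hz x hx
    simp [h1, h2]
  · refine mul_le_mul' le_rfl (measure_mono fun x (hx : π x = -1) => ?_)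
    have hxc : x ∈ cube c r := by
      by_contra hc
      rw [(hz x hc).2] at hx
      norm_num at hx
    obtain ⟨h1, h2⟩ := hab x hxc
    refine ⟨hxc, ?_, ?_⟩
    · show a x + σ * π x + b x = 0
      rw [hx, h1, h2]; linarith
    · show |σ| / 2 ≤ |a x + σ * π x|
      rw [hx, h1, show a₀ + σ * -1 = -b₀ by linarith, abs_neg]
      have := abs_add_le a₀ b₀
      rw [← hσ] at this
      linarith

theorem IsRefinement.swap {ε : ℝ} {f' g' a' b' : RSpace n → ℝ}
    (h : IsRefinement K p q f g a b C ε f' g' a' b') :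
    IsRefinement K q p g f b a C ε g' f' b' a' :=
  ⟨h.stage.swap, fun x => (h.close x).symm, by
    have := h.mass
    simpa only [add_comm] using this⟩

theorem IsStage.exists_refinement_cube (h : IsStage K p q f g a b C) (hK : IsCompact K)
    {c : RSpace n} {r ε a₀ b₀ : ℝ} (hr : 0 < r) (hε : 0 < ε) (hcK : cube c r ⊆ K)
    (hab : ∀ y ∈ cube c r, a y = a₀ ∧ b y = b₀) :
    ∃ f' g' a' b', IsRefinement K p q f g a b C ε f' g' a' b' ∧
      (∀ x, x ∉ cube c r → f' x = f x ∧ g' x = g x ∧ a' x = a x ∧ b' x = b x) ∧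
      volume (cube c r) ≤
        2 ^ n * volume {x | x ∈ cube c r ∧ a' x + b' x = 0 ∧ |a₀ + b₀| / 2 ≤ |a' x|} := by
  rcases le_total |a₀| |b₀| with hle | hle
  · exact h.exists_refinement_cube_aux hK hr hε hcK hab hle
  · obtain ⟨g', f', b', a', h1, h2, h3⟩ := h.swap.exists_refinement_cube_aux hK hr hε hcK
      (fun y hy => (hab y hy).symm) hle
    refine ⟨f', g', a', b', h1.swap, fun x hx => ?_, h3.trans ?_⟩
    · obtain ⟨e1, e2, e3, e4⟩ := h2 x hx
      exact ⟨e2, e1, e4, e3⟩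
    · refine mul_le_mul' le_rfl (measure_mono ?_)
      rintro x ⟨hx, hs, hb⟩
      refine ⟨hx, by rw [add_comm]; exact hs, ?_⟩
      rw [add_comm a₀, show a' x = -b' x by linarith, abs_neg]
      exact hb

theorem IsStage.exists_refinement_cubes (h : IsStage K p q f g a b C) (hK : IsCompact K)
    (F : Finset (RSpace n × ℝ)) :
    (∀ Q ∈ F, 0 < Q.2 ∧ cube Q.1 Q.2 ⊆ K ∧ ∀ y ∈ cube Q.1 Q.2, a y = a Q.1 ∧ b y = b Q.1) →
    (F : Set (RSpace n × ℝ)).PairwiseDisjoint (fun Q => cube Q.1 Q.2) → ∀ ε : ℝ, 0 < ε →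
    ∃ f' g' a' b', IsRefinement K p q f g a b C ε f' g' a' b' ∧
      (∀ x, (∀ Q ∈ F, x ∉ cube Q.1 Q.2) →
        f' x = f x ∧ g' x = g x ∧ a' x = a x ∧ b' x = b x) ∧
      ∀ Q ∈ F, volume (cube Q.1 Q.2) ≤ 2 ^ n * volume {x | x ∈ cube Q.1 Q.2 ∧ a' x + b' x = 0 ∧
        |a Q.1 + b Q.1| / 2 ≤ |a' x|} := by
  classical
  induction F using Finset.induction_on with
  | empty =>
    intro _ _ ε hε
    exact ⟨f, g, a, b, ⟨h.mono (by linarith), by simp [hε.le], rfl⟩, by simp, by simp⟩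
  | insert Q F hQF ih =>
    intro hF hdis ε hε
    have hdisQ : ∀ R ∈ F, ∀ x ∈ cube Q.1 Q.2, x ∉ cube R.1 R.2 := fun R hR x hx hx' =>
      Set.disjoint_left.1 (hdis (by simp) (by simp [hR]) (fun h => hQF (by rw [h]; exact hR))) hx hx'
    obtain ⟨f₁, g₁, a₁, b₁, hr₁, he₁, hv₁⟩ := ih (fun R hR => hF R (Finset.mem_insert_of_mem hR))
      (hdis.subset (by simp)) (ε / 2) (by positivity)
    obtain ⟨hQ0, hQK, hQab⟩ := hF Q (Finset.mem_insert_self _ _)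
    obtain ⟨f₂, g₂, a₂, b₂, hr₂, he₂, hv₂⟩ := hr₁.stage.exists_refinement_cube hK hQ0
      (half_pos hε) hQK (a₀ := a Q.1) (b₀ := b Q.1) (fun y hy => by
        obtain ⟨-, -, e3, e4⟩ := he₁ y fun R hR => hdisQ R hR y hy
        rw [e3, e4]; exact hQab y hy)
    refine ⟨f₂, g₂, a₂, b₂, ⟨?_, fun x => ?_, hr₂.mass.trans hr₁.mass⟩, fun x hx => ?_,
      fun R hR => ?_⟩
    · have := hr₂.stage
      rwa [show C + ε / 2 + ε / 2 = C + ε by ring] at this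
    · obtain ⟨c1, c2⟩ := hr₁.close x
      obtain ⟨c3, c4⟩ := hr₂.close x
      have t1 := abs_sub_le (f₂ x) (f₁ x) (f x)
      have t2 := abs_sub_le (g₂ x) (g₁ x) (g x)
      constructor <;> linarith
    · obtain ⟨e1, e2, e3, e4⟩ := he₁ x fun R hR => hx R (Finset.mem_insert_of_mem hR)
      obtain ⟨e5, e6, e7, e8⟩ := he₂ x (hx Q (Finset.mem_insert_self _ _))
      exact ⟨e5.trans e1, e6.trans e2, e7.trans e3, e8.trans e4⟩
    · rcases Finset.mem_insert.1 hR with rfl | hR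
      · exact hv₂
      · refine (hv₁ R hR).trans ?_
        refine mul_le_mul' le_rfl (measure_mono ?_)
        rintro x ⟨hx, hx2, hx3⟩
        obtain ⟨-, -, e7, e8⟩ := he₂ x fun hxQ => hdisQ R hR x hxQ hx
        exact ⟨hx, by rw [e7, e8]; exact hx2, by rw [e7]; exact hx3⟩

end Stage

section Covering

variable {n : ℕ}

/-- Every set is almost covered by countably many disjoint small cubes centred in it. -/
theorem exists_disjoint_cubes (U : Set (RSpace n)) (V : RSpace n → Set (RSpace n))
    (hV : ∀ x ∈ U, V x ∈ 𝓝 x) :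
    ∃ t : Set (RSpace n × ℝ), t.Countable ∧
      (∀ Q ∈ t, Q.1 ∈ U ∧ 0 < Q.2 ∧ cube Q.1 Q.2 ⊆ V Q.1) ∧
      t.PairwiseDisjoint (fun Q => cube Q.1 Q.2) ∧
      volume (U \ ⋃ Q ∈ t, cube Q.1 Q.2) = 0 := by
  classical
  let e := MeasurableEquiv.toLp 2 (Fin n → ℝ)
  have he : MeasurePreserving e.symm := EuclideanSpace.volume_preserving_symm_measurableEquiv_toLp _
  have hball : ∀ (x : Fin n → ℝ) {ρ : ℝ}, 0 ≤ ρ →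
      e.symm ⁻¹' Metric.closedBall x ρ = cube (e x) ρ := fun x ρ hρ => by
    ext y
    simp only [mem_preimage, Metric.mem_closedBall, dist_pi_le_iff hρ, Real.dist_eq, cube,
      mem_ofPred_eq]
    rfl
  have hR : ∀ x : Fin n → ℝ, ∃ R : ℝ, 0 < R ∧ (e x ∈ U → ∀ ρ, 0 ≤ ρ → ρ < R →
      cube (e x) ρ ⊆ V (e x)) := fun x => by
    by_cases hx : e x ∈ U
    · obtain ⟨δ, hδ, hb⟩ := Metric.mem_nhds_iff.1 (hV _ hx)
      refine ⟨δ / (√n + 1), by positivity, fun _ ρ hρ hρR => ?_⟩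
      refine (cube_subset_closedBall _ hρ).trans (Subset.trans ?_ hb)
      refine Metric.closedBall_subset_ball ?_
      rw [lt_div_iff₀ (by positivity)] at hρR
      nlinarith
    · exact ⟨1, one_pos, fun h => absurd h hx⟩
  choose R hR0 hRV using hR
  obtain ⟨t, r, htc, htU, htr, hnull, hdis⟩ :=
    Besicovitch.exists_disjoint_closedBall_covering_ae (volume : Measure (Fin n → ℝ))
      (fun _ => Ioi 0) (e ⁻¹' U) (fun x _ δ hδ => ⟨δ / 2, by simp [hδ]⟩) R (fun x _ => hR0 x)
  have hr0 : ∀ x ∈ t, 0 < r x := fun x hx => (htr x hx).1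
  refine ⟨(fun x => (e x, r x)) '' t, htc.image _, ?_, ?_, ?_⟩
  · rintro _ ⟨x, hx, rfl⟩
    exact ⟨htU hx, hr0 x hx, hRV x (htU hx) _ (hr0 x hx).le (htr x hx).2.2⟩
  · rintro _ ⟨x, hx, rfl⟩ _ ⟨y, hy, rfl⟩ hxy
    have hne : x ≠ y := fun h => hxy (by rw [h])
    have := (hdis hx hy hne).preimage e.symm
    simp only [Function.onFun] at this ⊢
    rwa [hball x (hr0 x hx).le, hball y (hr0 y hy).le] at this
  · rw [← he.measure_preimage_equiv] at hnull
    refine measure_mono_null ?_ hnull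
    rintro z ⟨hzU, hz⟩
    refine ⟨by simpa using hzU, fun hz' => hz ?_⟩
    simp only [mem_iUnion, exists_prop] at hz' ⊢
    obtain ⟨x, hx, hzx⟩ := hz'
    refine ⟨_, ⟨x, hx, rfl⟩, ?_⟩
    rw [← hball x (hr0 x hx).le]
    exact hzx

theorem exists_finset_sum_ge_half {ι : Type*} (t : Set ι) (ν : ι → ℝ≥0∞)
    (hfin : ∑' i : t, ν i ≠ ⊤) :
    ∃ F₀ : Finset ι, (F₀ : Set ι) ⊆ t ∧ ∑' i : t, ν i ≤ 2 * ∑ i ∈ F₀, ν i := by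
  classical
  by_cases h0 : ∑' i : t, ν i = 0
  · exact ⟨∅, by simp, by simp [h0]⟩
  · have h1 : (∑' i : t, ν i) / 2 < ∑' i : t, ν i := ENNReal.half_lt_self h0 hfin
    have h2 : Tendsto (fun s : Finset t => ∑ i ∈ s, ν i) atTop (𝓝 (∑' i : t, ν i)) :=
      ENNReal.summable.hasSum
    obtain ⟨s, hs⟩ := ((tendsto_order.1 h2).1 _ h1).exists
    refine ⟨s.map (Function.Embedding.subtype _), by simp, ?_⟩
    rw [Finset.sum_map]
    rw [ENNReal.div_lt_iff (by simp) (by simp), mul_comm] at hs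
    exact hs.le

end Covering

section Step

variable {n : ℕ} {K : Set (RSpace n)} {p q : Fin n} {f g a b : RSpace n → ℝ} {C : ℝ}

theorem IsStage.lintegral_enorm (h : IsStage K p q f g a b C) (hK : IsCompact K) :
    ∫⁻ x, ‖a x + b x‖ₑ = ENNReal.ofReal (∫ x, |a x + b x|) :=
  (ofReal_integral_norm_eq_lintegral_enorm
    ((h.integrable_a hK).add (h.swap.integrable_a hK))).symm

/-- One step of the construction: the unsettled region `{a + b ≠ 0}` loses a fixed fraction of its
volume, and the integral of `|a|` over the settled region grows by a fixed amount. -/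
theorem IsStage.exists_refinement (h : IsStage K p q f g a b C) (hK : IsCompact K) {ε : ℝ}
    (hε : 0 < ε) :
    ∃ f' g' a' b', IsRefinement K p q f g a b C ε f' g' a' b' ∧
      (∀ x, a x + b x = 0 → f' x = f x ∧ g' x = g x ∧ a' x = a x ∧ b' x = b x) ∧
      (∃ z, volume {x | a' x + b' x ≠ 0} + z ≤ volume {x | a x + b x ≠ 0} ∧
        volume {x | a x + b x ≠ 0} ≤ 2 ^ (n + 1) * z) ∧
      ∃ y, (∫⁻ x in {x | a x + b x = 0}, ‖a x‖ₑ) + y ≤ ∫⁻ x in {x | a' x + b' x = 0}, ‖a' x‖ₑ ∧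
        ∫⁻ x, ‖a x + b x‖ₑ ≤ 2 ^ (n + 2) * y := by
  classical
  set W : Set (RSpace n) := {x | a x + b x ≠ 0} with hW
  have hWm : MeasurableSet W :=
    (h.meas_a.add h.meas_b) (measurableSet_singleton (0 : ℝ)).compl
  have hWK : W ⊆ K := fun x hx => by
    by_contra hxK
    obtain ⟨-, -, h1, h2⟩ := h.off x hxK
    exact hx (by rw [h1, h2, add_zero])
  have hWfin : volume W ≠ ⊤ := ((measure_mono hWK).trans_lt hK.measure_lt_top).ne
  let U : Set (RSpace n) := {x | LocAffAt p q f g a b x ∧ x ∈ W}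
  have hUW : volume (W \ U) = 0 := by
    refine measure_mono_null ?_ h.loc
    rintro x ⟨hx, hxU⟩ hx'
    exact hxU ⟨hx', hx⟩
  obtain ⟨t, htc, ht, hdis, hnull⟩ := exists_disjoint_cubes U
    (fun x => {y | a y = a x ∧ b y = b x}) fun x hx => hx.1.mono fun y hy => ⟨hy.1, hy.2.1⟩
  have htW : ∀ Q ∈ t, cube Q.1 Q.2 ⊆ W := fun Q hQ y hy => by
    obtain ⟨h1, h2⟩ := (ht Q hQ).2.2 hy
    change a y + b y ≠ 0
    rw [h1, h2]
    exact (ht Q hQ).1.2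
  have hcm : ∀ Q : RSpace n × ℝ, MeasurableSet (cube Q.1 Q.2) := fun Q =>
    (isClosed_cube _ _).measurableSet
  have hcover : volume (W \ ⋃ Q ∈ t, cube Q.1 Q.2) = 0 := by
    refine measure_mono_null (t := (W \ U) ∪ (U \ ⋃ Q ∈ t, cube Q.1 Q.2)) ?_
      (measure_union_null hUW hnull)
    rintro x ⟨hx, hx'⟩
    by_cases hxU : x ∈ U
    · exact Or.inr ⟨hxU, hx'⟩
    · exact Or.inl ⟨hx, hxU⟩
  have hsub : (⋃ Q ∈ t, cube Q.1 Q.2) ⊆ W := iUnion₂_subset htW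
  have hWeq : W =ᵐ[volume] ⋃ Q ∈ t, cube Q.1 Q.2 :=
    (ae_le_set.2 hcover).antisymm (LE.le.eventuallyLE hsub)
  have hsum1 : volume W = ∑' Q : t, volume (cube Q.1.1 Q.1.2) := by
    rw [measure_congr hWeq, measure_biUnion htc hdis fun Q _ => hcm Q]
  let μs : Measure (RSpace n) := volume.withDensity fun x => ‖a x + b x‖ₑ
  have hμs : ∀ Q ∈ t, μs (cube Q.1 Q.2) = ‖a Q.1 + b Q.1‖ₑ * volume (cube Q.1 Q.2) :=
    fun Q hQ => by
      rw [withDensity_apply _ (hcm Q), setLIntegral_congr_fun (hcm Q) (g := fun _ =>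
        ‖a Q.1 + b Q.1‖ₑ) fun x hx => by
          obtain ⟨h1, h2⟩ := (ht Q hQ).2.2 hx
          simp only [h1, h2], setLIntegral_const]
  have hsum2 : ∫⁻ x, ‖a x + b x‖ₑ =
      ∑' Q : t, ‖a Q.1.1 + b Q.1.1‖ₑ * volume (cube Q.1.1 Q.1.2) := by
    have e1 : ∫⁻ x, ‖a x + b x‖ₑ = ∫⁻ x in W, ‖a x + b x‖ₑ := by
      rw [← lintegral_indicator hWm]
      refine lintegral_congr fun x => ?_
      by_cases hx : x ∈ W
      · rw [indicator_of_mem hx]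
      · rw [indicator_of_notMem hx, not_not.1 hx, enorm_zero]
    rw [e1, setLIntegral_congr hWeq, ← withDensity_apply _
      (MeasurableSet.biUnion htc fun Q _ => hcm Q), measure_biUnion htc hdis fun Q _ => hcm Q]
    exact tsum_congr fun Q => hμs Q.1 Q.2
  obtain ⟨F₁, hF₁, hF₁s⟩ := exists_finset_sum_ge_half t (fun Q => volume (cube Q.1 Q.2))
    (by rw [← hsum1]; exact hWfin)
  obtain ⟨F₂, hF₂, hF₂s⟩ := exists_finset_sum_ge_half t
    (fun Q => ‖a Q.1 + b Q.1‖ₑ * volume (cube Q.1 Q.2))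
    (by rw [← hsum2, h.lintegral_enorm hK]; exact ENNReal.ofReal_ne_top)
  let F := F₁ ∪ F₂
  have hF : ∀ Q ∈ F, Q ∈ t := fun Q hQ => by
    rcases Finset.mem_union.1 hQ with hQ | hQ
    · exact hF₁ hQ
    · exact hF₂ hQ
  rw [← hsum1] at hF₁s
  rw [← hsum2] at hF₂s
  obtain ⟨f', g', a', b', hr, heq, hvol⟩ := h.exists_refinement_cubes hK F
    (fun Q hQ => ⟨(ht Q (hF Q hQ)).2.1, (htW Q (hF Q hQ)).trans hWK,
      fun y hy => (ht Q (hF Q hQ)).2.2 hy⟩) (hdis.subset hF) ε hε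
  have heq0 : ∀ x, a x + b x = 0 → f' x = f x ∧ g' x = g x ∧ a' x = a x ∧ b' x = b x :=
    fun x hx => heq x fun Q hQ hxQ => htW Q (hF Q hQ) hxQ hx
  let Z : RSpace n × ℝ → Set (RSpace n) := fun Q => {x | x ∈ cube Q.1 Q.2 ∧ a' x + b' x = 0 ∧
    |a Q.1 + b Q.1| / 2 ≤ |a' x|}
  have hm' : MeasurableSet {x | a' x + b' x = 0} :=
    (hr.stage.meas_a.add hr.stage.meas_b) (measurableSet_singleton (0 : ℝ))
  have hZm : ∀ Q, MeasurableSet (Z Q) := fun Q =>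
    (hcm Q).inter (hm'.inter (measurableSet_le measurable_const hr.stage.meas_a.abs))
  have hZdis : (F : Set (RSpace n × ℝ)).PairwiseDisjoint Z := fun Q hQ R hR hQR =>
    (hdis (hF Q hQ) (hF R hR) hQR).mono (fun x hx => hx.1) fun x hx => hx.1
  have hZW : (⋃ Q ∈ F, Z Q) ⊆ W := iUnion₂_subset fun Q hQ x hx => htW Q (hF Q hQ) hx.1
  have hUm : MeasurableSet (⋃ Q ∈ F, Z Q) := F.measurableSet_biUnion fun Q _ => hZm Q
  refine ⟨f', g', a', b', hr, heq0, ⟨volume (⋃ Q ∈ F, Z Q), ?_, ?_⟩,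
    ∫⁻ x in ⋃ Q ∈ F, Z Q, ‖a' x‖ₑ, ?_, ?_⟩
  · rw [← measure_union _ hUm]
    · refine measure_mono (union_subset (fun x hx hx0 => hx ?_) hZW)
      obtain ⟨-, -, h1, h2⟩ := heq0 x hx0
      rw [h1, h2, hx0]
    · rw [Set.disjoint_left]
      intro x hx hxZ
      simp only [mem_iUnion, exists_prop] at hxZ
      obtain ⟨Q, -, hxQ⟩ := hxZ
      exact hx hxQ.2.1
  · rw [measure_biUnion_finset hZdis fun Q _ => hZm Q]
    calc volume W ≤ 2 * ∑ Q ∈ F₁, volume (cube Q.1 Q.2) := hF₁s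
      _ ≤ 2 * ∑ Q ∈ F, volume (cube Q.1 Q.2) := by
        gcongr; exact Finset.subset_union_left
      _ ≤ 2 * ∑ Q ∈ F, 2 ^ n * volume (Z Q) := by
        gcongr with Q hQ; exact hvol Q hQ
      _ = _ := by rw [← Finset.mul_sum, pow_succ]; ring
  · have hd : Disjoint {x | a x + b x = 0} (⋃ Q ∈ F, Z Q) := by
      rw [Set.disjoint_left]
      exact fun x hx hxZ => hZW hxZ hx
    have e1 : ∫⁻ x in {x | a x + b x = 0}, ‖a x‖ₑ = ∫⁻ x in {x | a x + b x = 0}, ‖a' x‖ₑ :=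
      setLIntegral_congr_fun ((h.meas_a.add h.meas_b) (measurableSet_singleton (0 : ℝ)))
        fun x hx => by simp only [(heq0 x hx).2.2.1]
    rw [e1, ← lintegral_union hUm hd]
    refine lintegral_mono_set (union_subset (fun x hx => ?_) (iUnion₂_subset fun Q _ x hx => hx.2.1))
    obtain ⟨-, -, h1, h2⟩ := heq0 x hx
    change a' x + b' x = 0
    rw [h1, h2]; exact hx
  · have hZi : ∀ Q ∈ F, ‖a Q.1 + b Q.1‖ₑ * volume (Z Q) ≤ 2 * ∫⁻ x in Z Q, ‖a' x‖ₑ :=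
      fun Q hQ => by
        rw [← setLIntegral_const, ← lintegral_const_mul _ hr.stage.meas_a.enorm]
        refine setLIntegral_mono (by have := hr.stage.meas_a; fun_prop) fun x hx => ?_
        have h2 : |a Q.1 + b Q.1| ≤ 2 * |a' x| := by linarith [hx.2.2]
        rw [← ofReal_norm, ← ofReal_norm, ← ENNReal.ofReal_ofNat,
          ← ENNReal.ofReal_mul (by norm_num)]
        exact ENNReal.ofReal_le_ofReal h2
    rw [lintegral_biUnion_finset hZdis fun Q _ => hZm Q]
    calc ∫⁻ x, ‖a x + b x‖ₑ ≤ 2 * ∑ Q ∈ F₂, ‖a Q.1 + b Q.1‖ₑ * volume (cube Q.1 Q.2) := hF₂s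
      _ ≤ 2 * ∑ Q ∈ F, ‖a Q.1 + b Q.1‖ₑ * volume (cube Q.1 Q.2) := by
        gcongr; exact Finset.subset_union_right
      _ ≤ 2 * ∑ Q ∈ F, 2 ^ n * (2 * ∫⁻ x in Z Q, ‖a' x‖ₑ) := by
        refine mul_le_mul' le_rfl (Finset.sum_le_sum fun Q hQ => ?_)
        calc ‖a Q.1 + b Q.1‖ₑ * volume (cube Q.1 Q.2)
            ≤ ‖a Q.1 + b Q.1‖ₑ * (2 ^ n * volume (Z Q)) := by gcongr; exact hvol Q hQ
          _ = 2 ^ n * (‖a Q.1 + b Q.1‖ₑ * volume (Z Q)) := by ring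
          _ ≤ _ := mul_le_mul' le_rfl (hZi Q hQ)
      _ = _ := by rw [← Finset.mul_sum, ← Finset.mul_sum, pow_add]; ring

end Step

section Limit

variable {n : ℕ} {K : Set (RSpace n)} {p q : Fin n}

/-- Near `x`, the displacement `f e_p + g e_q` is an affine function with skew gradient. -/
def LocRigidAt (p q : Fin n) (f g : RSpace n → ℝ) (x : RSpace n) : Prop :=
  ∃ α : ℝ, ∀ᶠ y in 𝓝 x, f y = f x + α * (y q - x q) ∧ g y = g x - α * (y p - x p)

theorem isOpen_setOf_locRigidAt (p q : Fin n) (f g : RSpace n → ℝ) :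
    IsOpen {x | LocRigidAt p q f g x} := by
  rw [isOpen_iff_mem_nhds]
  rintro x ⟨α, hα⟩
  filter_upwards [hα.eventually_nhds] with z hz
  refine ⟨α, hz.mono fun y hy => ?_⟩
  obtain ⟨h1, h2⟩ := hz.self_of_nhds
  rw [hy.1, hy.2, h1, h2]
  constructor <;> ring

theorem partialDeriv_of_eventually_affine {q : Fin n} {f : RSpace n → ℝ} {x : RSpace n} {α : ℝ}
    (h : ∀ᶠ y in 𝓝 x, f y = f x + α * (y q - x q)) : partialDeriv q f x = α := by
  have e : f =ᶠ[𝓝 x] fun y => f x + α * (y q - x q) := h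
  have hd : HasFDerivAt (fun y : RSpace n => f x + α * (y q - x q))
      (α • (EuclideanSpace.proj q : RSpace n →L[ℝ] ℝ)) x :=
    (((EuclideanSpace.proj q : RSpace n →L[ℝ] ℝ).hasFDerivAt.sub_const _).const_mul α).const_add _
  unfold partialDeriv
  rw [e.fderiv_eq, hd.fderiv]
  simp

/-- A stage together with its functions. -/
structure StageData (K : Set (RSpace n)) (p q : Fin n) where
  f : RSpace n → ℝ
  g : RSpace n → ℝ
  a : RSpace n → ℝ
  b : RSpace n → ℝ
  C : ℝ
  isStage : IsStage K p q f g a b C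

/-- `t` arises from `s` by one step of the construction. -/
structure StageData.IsNext (ε : ℝ) (s t : StageData K p q) : Prop where
  C_eq : t.C = s.C + ε
  close : ∀ x, |t.f x - s.f x| ≤ ε ∧ |t.g x - s.g x| ≤ ε
  mass : ∫ x, |t.a x + t.b x| = ∫ x, |s.a x + s.b x|
  keep : ∀ x, s.a x + s.b x = 0 → t.f x = s.f x ∧ t.g x = s.g x ∧ t.a x = s.a x ∧ t.b x = s.b x
  loss : ∃ z, volume {x | t.a x + t.b x ≠ 0} + z ≤ volume {x | s.a x + s.b x ≠ 0} ∧
    volume {x | s.a x + s.b x ≠ 0} ≤ 2 ^ (n + 1) * z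
  gain : ∃ y, (∫⁻ x in {x | s.a x + s.b x = 0}, ‖s.a x‖ₑ) + y
      ≤ ∫⁻ x in {x | t.a x + t.b x = 0}, ‖t.a x‖ₑ ∧
    ∫⁻ x, ‖s.a x + s.b x‖ₑ ≤ 2 ^ (n + 2) * y

theorem StageData.exists_isNext (hK : IsCompact K) (s : StageData K p q) {ε : ℝ} (hε : 0 < ε) :
    ∃ t, s.IsNext ε t := by
  obtain ⟨f, g, a, b, h1, h2, h3, h4⟩ := s.isStage.exists_refinement hK hε
  exact ⟨⟨f, g, a, b, _, h1.stage⟩, rfl, h1.close, h1.mass, h2, h3, h4⟩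

theorem StageData.exists_seq (hK : IsCompact K) (s₀ : StageData K p q) :
    ∃ s : ℕ → StageData K p q, s 0 = s₀ ∧ ∀ k, (s k).IsNext (1 / 2 / 2 ^ k) (s (k + 1)) := by
  choose nxt hnxt using fun (k : ℕ) (s : StageData K p q) =>
    s.exists_isNext hK (ε := 1 / 2 / 2 ^ k) (by positivity)
  exact ⟨fun k => Nat.rec s₀ (fun k s => nxt k s) k, rfl, fun k => hnxt k _⟩

theorem ENNReal.eq_zero_of_forall_nat_mul_le {c m : ℝ≥0∞} (hm : m ≠ ⊤)
    (h : ∀ k : ℕ, k * c ≤ m) : c = 0 := by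
  by_contra hc
  obtain ⟨k, hk⟩ := ENNReal.exists_nat_mul_gt hc hm
  exact absurd (h k) (not_le.2 hk)

theorem exists_uniform_limit {f : ℕ → RSpace n → ℝ} (hf : ∀ k, Continuous (f k))
    (h : ∀ k x, |f (k + 1) x - f k x| ≤ 1 / 2 / 2 ^ k) :
    ∃ F : RSpace n → ℝ, Continuous F ∧ (∀ x, Tendsto (fun k => f k x) atTop (𝓝 (F x))) ∧
      ∀ k x, |f k x - F x| ≤ 1 := by
  have h' : ∀ x k, dist (f k x) (f (k + 1) x) ≤ 1 / 2 / 2 ^ k := fun x k => by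
    rw [dist_comm, Real.dist_eq]; exact h k x
  choose F hF using fun x => cauchySeq_tendsto_of_complete (cauchySeq_of_le_geometric_two (h' x))
  have hd : ∀ k x, dist (f k x) (F x) ≤ 1 / 2 ^ k := fun k x =>
    dist_le_of_le_geometric_two_of_tendsto (h' x) (hF x) k
  refine ⟨F, ?_, hF, fun k x => (hd k x).trans ?_⟩
  · refine TendstoUniformly.continuous (F := f) (p := atTop) ?_ (Frequently.of_forall hf)
    rw [Metric.tendstoUniformly_iff]
    intro ε hε
    have h0 : Tendsto (fun k : ℕ => (1 : ℝ) / 2 ^ k) atTop (𝓝 0) := by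
      simpa using tendsto_pow_atTop_nhds_zero_of_lt_one (r := (1 / 2 : ℝ)) (by norm_num)
        (by norm_num)
    filter_upwards [(tendsto_order.1 h0).2 ε hε] with k hk x
    rw [dist_comm]
    exact (hd k x).trans_lt hk
  · exact (div_le_one (by positivity)).2 (one_le_pow₀ (by norm_num))

theorem tendsto_integral_mul_of_close (hK : IsCompact K) {f : ℕ → RSpace n → ℝ}
    {F : RSpace n → ℝ} (hf : ∀ k, Continuous (f k)) (hF : Continuous F)
    (hF0 : ∀ x, x ∉ K → F x = 0) (hlim : ∀ x, Tendsto (fun k => f k x) atTop (𝓝 (F x)))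
    (hclose : ∀ k x, |f k x - F x| ≤ 1) {ψ : RSpace n → ℝ} (hψ : Continuous ψ)
    (hψi : Integrable ψ) :
    Tendsto (fun k => ∫ x, f k x * ψ x) atTop (𝓝 (∫ x, F x * ψ x)) := by
  refine tendsto_integral_of_dominated_convergence (fun x => |F x * ψ x| + |ψ x|)
    (fun k => ((hf k).mul hψ).aestronglyMeasurable)
    ((integrable_mul_of_continuous_off hK hF hF0 hψ).abs.add hψi.abs)
    (fun k => Eventually.of_forall fun x => ?_)
    (Eventually.of_forall fun x => (hlim x).mul_const _)
  rw [Real.norm_eq_abs, show f k x * ψ x = F x * ψ x + (f k x - F x) * ψ x by ring]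
  refine (abs_add_le _ _).trans ?_
  rw [abs_mul (f k x - F x)]
  have := mul_le_mul_of_nonneg_right (hclose k x) (abs_nonneg (ψ x))
  linarith

/-- The displacement `f e_p + g e_q` has a measure-valued strain, is rigid near almost every point,
and the corresponding derivative of `f` is not integrable. -/
structure IsCantorPair (K : Set (RSpace n)) (p q : Fin n) (f g : RSpace n → ℝ) (C : ℝ) :
    Prop where
  cont_f : Continuous f
  cont_g : Continuous g
  off : ∀ x, x ∉ K → f x = 0 ∧ g x = 0
  rigid : ∀ᵐ x, LocRigidAt p q f g x
  small_f : ∀ j, j ≠ q → ∀ φ, IsTestFn univ φ → ∀ B, (∀ x, |φ x| ≤ B) →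
    |∫ y, f y * partialDeriv j φ y| ≤ C * B
  small_g : ∀ j, j ≠ p → ∀ φ, IsTestFn univ φ → ∀ B, (∀ x, |φ x| ≤ B) →
    |∫ y, g y * partialDeriv j φ y| ≤ C * B
  small_shear : ∀ φ, IsTestFn univ φ → ∀ B, (∀ x, |φ x| ≤ B) →
    |(∫ y, f y * partialDeriv q φ y) + ∫ y, g y * partialDeriv p φ y| ≤ C * B
  large : ∫⁻ x in {x | LocRigidAt p q f g x}, ‖partialDeriv q f x‖ₑ = ⊤

theorem StageData.exists_isCantorPair (hK : IsCompact K) (s₀ : StageData K p q)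
    (h0 : ∫⁻ x, ‖s₀.a x + s₀.b x‖ₑ ≠ 0) :
    ∃ f g C, IsCantorPair K p q f g C := by
  obtain ⟨s, hs0, hs⟩ := s₀.exists_seq hK
  obtain ⟨f, hf, hflim, hfc⟩ := exists_uniform_limit (f := fun k => (s k).f)
    (fun k => (s k).isStage.cont_f) fun k x => ((hs k).close x).1
  obtain ⟨g, hg, hglim, hgc⟩ := exists_uniform_limit (f := fun k => (s k).g)
    (fun k => (s k).isStage.cont_g) fun k x => ((hs k).close x).2
  have hf0 : ∀ x, x ∉ K → f x = 0 := fun x hx =>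
    tendsto_nhds_unique (hflim x) (tendsto_const_nhds.congr fun k => ((s k).isStage.off x hx).1.symm)
  have hg0 : ∀ x, x ∉ K → g x = 0 := fun x hx =>
    tendsto_nhds_unique (hglim x)
      (tendsto_const_nhds.congr fun k => ((s k).isStage.off x hx).2.1.symm)
  have hC : ∀ k, (s k).C = s₀.C + 1 - 1 / 2 ^ k := fun k => by
    induction k with
    | zero => simp [hs0]
    | succ k ih => rw [(hs k).C_eq, ih, pow_succ]; field_simp; ring
  have hC1 : ∀ k, (s k).C ≤ s₀.C + 1 := fun k => by
    rw [hC]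
    have : (0 : ℝ) < 1 / 2 ^ k := by positivity
    linarith
  set M := ∫ x, |s₀.a x + s₀.b x| with hM
  have hMk : ∀ k, ∫ x, |(s k).a x + (s k).b x| = M := fun k => by
    induction k with
    | zero => rw [hs0]
    | succ k ih => rw [(hs k).mass, ih]
  have hkeep : ∀ k m, k ≤ m → ∀ x, (s k).a x + (s k).b x = 0 → (s m).f x = (s k).f x ∧
      (s m).g x = (s k).g x ∧ (s m).a x = (s k).a x ∧ (s m).b x = (s k).b x := by
    intro k m hkm x hx
    induction m, hkm using Nat.le_induction with
    | base => simp
    | succ m _ ih =>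
      obtain ⟨h1, h2, h3, h4⟩ := ih
      obtain ⟨h5, h6, h7, h8⟩ := (hs m).keep x (by rw [h3, h4, hx])
      exact ⟨h5.trans h1, h6.trans h2, h7.trans h3, h8.trans h4⟩
  have hfin : ∀ k x, (s k).a x + (s k).b x = 0 → f x = (s k).f x ∧ g x = (s k).g x :=
    fun k x hx =>
      ⟨tendsto_nhds_unique (hflim x) (tendsto_const_nhds.congr' <| by
          filter_upwards [eventually_ge_atTop k] with m hm using (hkeep k m hm x hx).1.symm),
        tendsto_nhds_unique (hglim x) (tendsto_const_nhds.congr' <| by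
          filter_upwards [eventually_ge_atTop k] with m hm using (hkeep k m hm x hx).2.1.symm)⟩
  have haff : ∀ k x, LocAffAt p q (s k).f (s k).g (s k).a (s k).b x →
      (s k).a x + (s k).b x = 0 →
      ∀ᶠ y in 𝓝 x, f y = f x + (s k).a x * (y q - x q) ∧ g y = g x - (s k).a x * (y p - x p) := by
    intro k x hx hx0
    filter_upwards [hx] with y hy
    obtain ⟨h1, h2, h3, h4⟩ := hy
    obtain ⟨h5, h6⟩ := hfin k x hx0
    obtain ⟨h7, h8⟩ := hfin k y (by rw [h1, h2, hx0])
    rw [h5, h6, h7, h8, h3, h4, show (s k).b x = -(s k).a x by linarith]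
    constructor <;> ring
  have hbad : ∀ k, volume {x | ¬ LocRigidAt p q f g x} ≤
      volume {x | (s k).a x + (s k).b x ≠ 0} := fun k => by
    refine measure_mono_ae ?_
    filter_upwards [(s k).isStage.loc] with x hx hbad hx0
    exact hbad ⟨_, haff k x hx hx0⟩
  have hbad0 : volume {x | ¬ LocRigidAt p q f g x} = 0 := by
    have hm0 : volume {x | (s 0).a x + (s 0).b x ≠ 0} ≠ ⊤ := by
      refine ((measure_mono fun x hx => ?_).trans_lt hK.measure_lt_top).ne
      by_contra hxK
      obtain ⟨-, -, h1, h2⟩ := (s 0).isStage.off x hxK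
      exact hx (by rw [h1, h2, add_zero])
    have h1 : ∀ k : ℕ, volume {x | (s k).a x + (s k).b x ≠ 0} +
        k * (volume {x | ¬ LocRigidAt p q f g x} / 2 ^ (n + 1)) ≤
        volume {x | (s 0).a x + (s 0).b x ≠ 0} := fun k => by
      induction k with
      | zero => simp
      | succ k ih =>
        obtain ⟨z, hz1, hz2⟩ := (hs k).loss
        have hz : volume {x | ¬ LocRigidAt p q f g x} / 2 ^ (n + 1) ≤ z :=
          ENNReal.div_le_of_le_mul' ((hbad k).trans hz2)
        refine le_trans ?_ ih
        push_cast
        rw [add_mul, one_mul, add_comm (_ * _), ← add_assoc]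
        gcongr
        exact (add_le_add le_rfl hz).trans hz1
    have h2 := ENNReal.eq_zero_of_forall_nat_mul_le hm0 fun k => le_add_self.trans (h1 k)
    rw [ENNReal.div_eq_zero_iff] at h2
    exact h2.resolve_right (by simp)
  have hlarge : ∫⁻ x in {x | LocRigidAt p q f g x}, ‖partialDeriv q f x‖ₑ = ⊤ := by
    have hA : ∀ k, ∫⁻ x in {x | (s k).a x + (s k).b x = 0}, ‖(s k).a x‖ₑ ≤
        ∫⁻ x in {x | LocRigidAt p q f g x}, ‖partialDeriv q f x‖ₑ := fun k => by
      have hm : MeasurableSet {x | (s k).a x + (s k).b x = 0} :=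
        ((s k).isStage.meas_a.add (s k).isStage.meas_b) (measurableSet_singleton (0 : ℝ))
      rw [← lintegral_indicator hm,
        ← lintegral_indicator (isOpen_setOf_locRigidAt p q f g).measurableSet]
      refine lintegral_mono_ae ?_
      filter_upwards [(s k).isStage.loc] with x hx
      by_cases hx0 : (s k).a x + (s k).b x = 0
      · have ha := haff k x hx hx0
        rw [indicator_of_mem (show x ∈ {x | LocRigidAt p q f g x} from ⟨_, ha⟩),
          indicator_of_mem (by exact hx0),
          partialDeriv_of_eventually_affine (ha.mono fun y hy => hy.1)]
      · rw [indicator_of_notMem (by exact hx0)]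
        exact zero_le
    have hmass : ∀ k, ∫⁻ x, ‖(s k).a x + (s k).b x‖ₑ = ∫⁻ x, ‖s₀.a x + s₀.b x‖ₑ := fun k => by
      rw [(s k).isStage.lintegral_enorm hK, s₀.isStage.lintegral_enorm hK, hMk]
    have hB : ∀ k : ℕ, k * ((∫⁻ x, ‖s₀.a x + s₀.b x‖ₑ) / 2 ^ (n + 2)) ≤
        ∫⁻ x in {x | (s k).a x + (s k).b x = 0}, ‖(s k).a x‖ₑ := fun k => by
      induction k with
      | zero => simp
      | succ k ih =>
        obtain ⟨z, hz1, hz2⟩ := (hs k).gain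
        rw [hmass] at hz2
        refine le_trans ?_ hz1
        push_cast
        rw [add_mul, one_mul]
        exact add_le_add ih (ENNReal.div_le_of_le_mul' hz2)
    by_contra hne
    have h2 := ENNReal.eq_zero_of_forall_nat_mul_le hne fun k => (hB k).trans (hA k)
    rw [ENNReal.div_eq_zero_iff] at h2
    exact h2.elim h0 (by simp)
  have htf : ∀ (j : Fin n) φ, IsTestFn univ φ →
      Tendsto (fun k => ∫ y, (s k).f y * partialDeriv j φ y) atTop
        (𝓝 (∫ y, f y * partialDeriv j φ y)) := fun j φ hφ =>
    tendsto_integral_mul_of_close hK (fun k => (s k).isStage.cont_f) hf hf0 hflim hfc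
      (hφ.continuous_partialDeriv j) (hφ.integrable_partialDeriv j)
  have htg : ∀ (j : Fin n) φ, IsTestFn univ φ →
      Tendsto (fun k => ∫ y, (s k).g y * partialDeriv j φ y) atTop
        (𝓝 (∫ y, g y * partialDeriv j φ y)) := fun j φ hφ =>
    tendsto_integral_mul_of_close hK (fun k => (s k).isStage.cont_g) hg hg0 hglim hgc
      (hφ.continuous_partialDeriv j) (hφ.integrable_partialDeriv j)
  have hM0 : 0 ≤ M := integral_nonneg fun x => abs_nonneg _
  refine ⟨f, g, max (s₀.C + 1) M, hf, hg, fun x hx => ⟨hf0 x hx, hg0 x hx⟩, hbad0, ?_, ?_, ?_,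
    hlarge⟩
  · intro j hj φ hφ B hB
    have hB0 : 0 ≤ B := (abs_nonneg _).trans (hB 0)
    refine le_of_tendsto (htf j φ hφ).abs (Eventually.of_forall fun k => ?_)
    refine ((s k).isStage.small_f j hj φ hφ B hB).trans ?_
    gcongr
    exact (hC1 k).trans (le_max_left _ _)
  · intro j hj φ hφ B hB
    have hB0 : 0 ≤ B := (abs_nonneg _).trans (hB 0)
    refine le_of_tendsto (htg j φ hφ).abs (Eventually.of_forall fun k => ?_)
    refine ((s k).isStage.small_g j hj φ hφ B hB).trans ?_
    gcongr
    exact (hC1 k).trans (le_max_left _ _)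
  · intro φ hφ B hB
    have hB0 : 0 ≤ B := (abs_nonneg _).trans (hB 0)
    refine le_of_tendsto ((htf q φ hφ).add (htg p φ hφ)).abs (Eventually.of_forall fun k => ?_)
    have hst := (s k).isStage
    obtain ⟨D, hD⟩ := hst.bdd
    have i1 : Integrable fun y => (s k).a y * φ y :=
      hφ.integrable.bdd_mul (c := D) hst.meas_a.aestronglyMeasurable
        (Eventually.of_forall fun x => (hD x).1)
    have i2 : Integrable fun y => (s k).b y * φ y :=
      hφ.integrable.bdd_mul (c := D) hst.meas_b.aestronglyMeasurable
        (Eventually.of_forall fun x => (hD x).2)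
    rw [hst.weak_f φ hφ, hst.weak_g φ hφ, ← neg_add, abs_neg, ← integral_add i1 i2]
    calc |∫ y, ((s k).a y * φ y + (s k).b y * φ y)|
        ≤ ∫ y, |(s k).a y * φ y + (s k).b y * φ y| := abs_integral_le_integral_abs
      _ ≤ ∫ y, |(s k).a y + (s k).b y| * B := by
        refine integral_mono (i1.add i2).abs
          (((hst.integrable_a hK).add (hst.swap.integrable_a hK)).abs.mul_const B) fun y => ?_
        beta_reduce
        rw [← add_mul, abs_mul]
        exact mul_le_mul_of_nonneg_left (hB y) (abs_nonneg _)
      _ = M * B := by rw [integral_mul_const, hMk]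
      _ ≤ _ := by gcongr; exact le_max_right _ _

theorem exists_isCantorPair (p q : Fin n) (c : RSpace n) {r : ℝ} (hr : 0 < r) :
    ∃ f g C, IsCantorPair (cube c r) p q f g C := by
  obtain ⟨Ψ, π, hΨc, hπm, hz, hΨb, hπ1, hloc, hw, hs, hvol⟩ := exists_profile q c hr one_pos
  have hK := isCompact_cube c hr.le
  have hst := (isStage_zero (cube c r) p q).add_profile hK Subset.rfl hΨc hπm hz hπ1 hloc hw hs 1
    zero_le_one
  refine StageData.exists_isCantorPair hK ⟨_, _, _, _, _, hst⟩ ?_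
  simp only [zero_add, one_mul, add_zero]
  intro h0
  rw [lintegral_eq_zero_iff hπm.enorm] at h0
  have h1 : volume {y | π y = -1} = 0 := by
    refine measure_mono_null ?_ h0
    intro y hy hy0
    rw [mem_ofPred_eq] at hy
    simp [hy] at hy0
  have h2 : volume (cube c r) ≠ 0 := by
    rw [volume_cube c hr.le]
    positivity
  rw [h1, mul_zero] at hvol
  exact h2 (le_antisymm hvol zero_le)

end Limit

section Field

variable {n : ℕ} {K : Set (RSpace n)} {p q : Fin n} {f g : RSpace n → ℝ} {C : ℝ}

/-- The vector field `f e_p + g e_q`. -/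
noncomputable def pairField (p q : Fin n) (f g : RSpace n → ℝ) (y : RSpace n) : RSpace n :=
  f y • EuclideanSpace.single p 1 + g y • EuclideanSpace.single q 1

theorem pairField_apply (p q : Fin n) (f g : RSpace n → ℝ) (y : RSpace n) (k : Fin n) :
    pairField p q f g y k = (if k = p then f y else 0) + if k = q then g y else 0 := by
  simp [pairField]

theorem LocRigidAt.exists_isOpen {x : RSpace n} (h : LocRigidAt p q f g x) :
    ∃ (α : ℝ) (U : Set (RSpace n)), IsOpen U ∧ x ∈ U ∧
      ∀ y ∈ U, ∀ z ∈ U, f z = f y + α * (z q - y q) ∧ g z = g y + -α * (z p - y p) := by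
  obtain ⟨α, hα⟩ := h
  obtain ⟨U, hU, hUo, hxU⟩ := eventually_nhds_iff.1 hα
  refine ⟨α, U, hUo, hxU, fun y hy z hz => ?_⟩
  rw [(hU y hy).1, (hU y hy).2, (hU z hz).1, (hU z hz).2]
  constructor <;> ring

theorem hasFDerivAt_coord_affine (q : Fin n) (c α : ℝ) (x y : RSpace n) :
    HasFDerivAt (fun z : RSpace n => c + α * (z q - x q))
      (α • (EuclideanSpace.proj q : RSpace n →L[ℝ] ℝ)) y :=
  (((EuclideanSpace.proj q : RSpace n →L[ℝ] ℝ).hasFDerivAt.sub_const _).const_mul α).const_add _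

theorem integral_mul_partialDeriv_of_affine {U : Set (RSpace n)} (hU : IsOpen U)
    (hfc : Continuous f) {α : ℝ} (hf : ∀ y ∈ U, ∀ z ∈ U, f z = f y + α * (z q - y q))
    {φ : RSpace n → ℝ} (hφ : IsTestFn U φ) (j : Fin n) :
    ∫ y, f y * partialDeriv j φ y = -((if j = q then α else 0) * ∫ y, φ y) := by
  have hd : ∀ y ∈ U, HasFDerivAt f (α • (EuclideanSpace.proj q : RSpace n →L[ℝ] ℝ)) y :=
    fun y hy => by
      refine (hasFDerivAt_coord_affine q (f y) α y y).congr_of_eventuallyEq ?_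
      filter_upwards [hU.mem_nhds hy] with z hz using hf y hy z hz
  have he : ∀ y, fderiv ℝ f y (EuclideanSpace.single j 1) * φ y =
      (if j = q then α else 0) * φ y := fun y => by
    by_cases hy : y ∈ tsupport φ
    · rw [(hd y (hφ.2.2 hy)).fderiv]
      by_cases hjq : j = q
      · simp [hjq]
      · simp [hjq, Ne.symm hjq]
    · rw [image_eq_zero_of_notMem_tsupport hy, mul_zero, mul_zero]
  have key := integral_mul_fderiv_eq_neg_fderiv_mul_of_integrable (μ := volume) (f := f) (g := φ)
    (v := EuclideanSpace.single j 1) (by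
      simp only [he]; exact hφ.integrable.const_mul _)
    ((hfc.mul (hφ.continuous_partialDeriv j)).integrable_of_hasCompactSupport
      (hφ.hasCompactSupport_partialDeriv j).mul_left)
    ((hfc.mul hφ.1.continuous).integrable_of_hasCompactSupport hφ.2.1.mul_left)
    (fun y hy => (hd y (hφ.2.2 hy)).differentiableAt)
    (fun y _ => (hφ.1.differentiable (by simp)).differentiableAt)
  simp only [he, integral_const_mul] at key
  exact key

theorem partialDeriv_add {φ ψ : RSpace n → ℝ} {Ω : Set (RSpace n)} (hφ : IsTestFn Ω φ)
    (hψ : IsTestFn Ω ψ) (j : Fin n) (x : RSpace n) :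
    partialDeriv j (φ + ψ) x = partialDeriv j φ x + partialDeriv j ψ x := by
  unfold partialDeriv
  rw [fderiv_add ((hφ.1.differentiable (by simp)) x) ((hψ.1.differentiable (by simp)) x)]
  rfl

theorem partialDeriv_smul {φ : RSpace n → ℝ} {Ω : Set (RSpace n)} (hφ : IsTestFn Ω φ)
    (c : ℝ) (j : Fin n) (x : RSpace n) :
    partialDeriv j (c • φ) x = c * partialDeriv j φ x := by
  unfold partialDeriv
  rw [fderiv_const_smul ((hφ.1.differentiable (by simp)) x)]
  rfl

theorem IsTestFn.partialDeriv_eq_zero {Ω : Set (RSpace n)} {φ : RSpace n → ℝ}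
    (hφ : IsTestFn Ω φ) (j : Fin n) {x : RSpace n} (hx : x ∉ Ω) : partialDeriv j φ x = 0 := by
  have : x ∉ tsupport (fderiv ℝ φ) := fun h => hx (hφ.2.2 (tsupport_fderiv_subset ℝ h))
  rw [partialDeriv, image_eq_zero_of_notMem_tsupport this]
  rfl

/-- The distributional strain of `f e_p + g e_q`, with the opposite sign. -/
noncomputable def strainPairing (p q : Fin n) (f g : RSpace n → ℝ) (i j : Fin n)
    (φ : RSpace n → ℝ) : ℝ :=
  -∫ x, (pairField p q f g x i * partialDeriv j φ x +
    pairField p q f g x j * partialDeriv i φ x) / 2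


theorem continuous_pairField (hf : Continuous f) (hg : Continuous g) :
    Continuous (pairField p q f g) := by
  unfold pairField; fun_prop

theorem integrable_pairField_mul (hf : Continuous f) (hg : Continuous g) {Ω : Set (RSpace n)}
    {φ : RSpace n → ℝ} (hφ : IsTestFn Ω φ) (i j : Fin n) :
    Integrable fun x => pairField p q f g x i * partialDeriv j φ x :=
  (((EuclideanSpace.proj i : RSpace n →L[ℝ] ℝ).continuous.comp
    (continuous_pairField hf hg)).mul (hφ.continuous_partialDeriv j)).integrable_of_hasCompactSupport
      (hφ.hasCompactSupport_partialDeriv j).mul_left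

theorem integral_pairField_mul (hpq : p ≠ q) (φ : RSpace n → ℝ) (i j : Fin n) :
    ∫ x, pairField p q f g x i * partialDeriv j φ x =
      (if i = p then ∫ x, f x * partialDeriv j φ x else 0) +
        if i = q then ∫ x, g x * partialDeriv j φ x else 0 := by
  simp only [pairField_apply]
  by_cases h1 : i = p
  · have h2 : i ≠ q := h1 ▸ hpq
    simp [h1, hpq]
  · simp [h1]
    by_cases h2 : i = q <;> simp [h2]

theorem strainPairing_eq (hpq : p ≠ q) (hf : Continuous f) (hg : Continuous g)
    {Ω : Set (RSpace n)} {φ : RSpace n → ℝ} (hφ : IsTestFn Ω φ) (i j : Fin n) :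
    strainPairing p q f g i j φ =
      -((((if i = p then ∫ x, f x * partialDeriv j φ x else 0) +
        if i = q then ∫ x, g x * partialDeriv j φ x else 0) +
      ((if j = p then ∫ x, f x * partialDeriv i φ x else 0) +
        if j = q then ∫ x, g x * partialDeriv i φ x else 0)) / 2) := by
  rw [strainPairing, integral_div, integral_add (integrable_pairField_mul hf hg hφ i j)
    (integrable_pairField_mul hf hg hφ j i), integral_pairField_mul hpq, integral_pairField_mul hpq]

theorem strainPairing_add (hf : Continuous f) (hg : Continuous g) {Ω : Set (RSpace n)}
    {φ ψ : RSpace n → ℝ} (hφ : IsTestFn Ω φ) (hψ : IsTestFn Ω ψ) (i j : Fin n) :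
    strainPairing p q f g i j (φ + ψ) =
      strainPairing p q f g i j φ + strainPairing p q f g i j ψ := by
  have hI : ∀ {χ : RSpace n → ℝ}, IsTestFn Ω χ → Integrable fun x =>
      (pairField p q f g x i * partialDeriv j χ x +
        pairField p q f g x j * partialDeriv i χ x) / 2 := fun hχ =>
    ((integrable_pairField_mul hf hg hχ i j).add (integrable_pairField_mul hf hg hχ j i)).div_const 2
  unfold strainPairing
  rw [← neg_add, ← integral_add (hI hφ) (hI hψ)]
  congr 2
  ext x
  rw [partialDeriv_add hφ hψ, partialDeriv_add hφ hψ]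
  ring

theorem strainPairing_smul {Ω : Set (RSpace n)} {φ : RSpace n → ℝ} (hφ : IsTestFn Ω φ) (c : ℝ)
    (i j : Fin n) :
    strainPairing p q f g i j (c • φ) = c * strainPairing p q f g i j φ := by
  unfold strainPairing
  rw [mul_neg, ← integral_const_mul]
  congr 2
  ext x
  rw [partialDeriv_smul hφ, partialDeriv_smul hφ]
  ring

theorem strainPairing_eq_zero_of_rigid (hpq : p ≠ q) (hf : Continuous f) (hg : Continuous g)
    {U : Set (RSpace n)} (hU : IsOpen U) {α : ℝ}
    (h : ∀ y ∈ U, ∀ z ∈ U, f z = f y + α * (z q - y q) ∧ g z = g y + -α * (z p - y p))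
    {φ : RSpace n → ℝ} (hφ : IsTestFn U φ) (i j : Fin n) :
    strainPairing p q f g i j φ = 0 := by
  rw [strainPairing_eq hpq hf hg hφ]
  simp only [integral_mul_partialDeriv_of_affine hU hf (fun y hy z hz => (h y hy z hz).1) hφ,
    integral_mul_partialDeriv_of_affine hU hg (fun y hy z hz => (h y hy z hz).2) hφ]
  by_cases h1 : i = p <;> by_cases h2 : i = q <;> by_cases h3 : j = p <;> by_cases h4 : j = q <;>
    simp_all

theorem IsCantorPair.abs_strainPairing_le (h : IsCantorPair K p q f g C) (hpq : p ≠ q)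
    {φ : RSpace n → ℝ} (hφ : IsTestFn univ φ) {B : ℝ} (hB : ∀ x, |φ x| ≤ B) (i j : Fin n) :
    |strainPairing p q f g i j φ| ≤ C * B := by
  have hC : 0 ≤ C * B := (abs_nonneg _).trans (h.small_shear φ hφ B hB)
  have hone : ∀ k l : Fin n, ¬ (k = p ∧ l = q) → ¬ (k = q ∧ l = p) →
      |(if k = p then ∫ x, f x * partialDeriv l φ x else 0) +
        if k = q then ∫ x, g x * partialDeriv l φ x else 0| ≤ C * B := fun k l h1 h2 => by
    by_cases hk : k = p
    · have hkq : k ≠ q := hk ▸ hpq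
      rw [if_pos hk, if_neg hkq, add_zero]
      exact h.small_f l (fun hl => h1 ⟨hk, hl⟩) φ hφ B hB
    · rw [if_neg hk, zero_add]
      by_cases hkq : k = q
      · rw [if_pos hkq]
        exact h.small_g l (fun hl => h2 ⟨hkq, hl⟩) φ hφ B hB
      · simpa [hkq] using hC
  rw [strainPairing_eq hpq h.cont_f h.cont_g hφ, abs_neg, abs_div, abs_two]
  by_cases h1 : i = p ∧ j = q
  · obtain ⟨rfl, rfl⟩ := h1
    rw [if_pos rfl, if_neg hpq, if_neg hpq.symm, if_pos rfl, add_zero, zero_add]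
    have := h.small_shear φ hφ B hB
    linarith
  by_cases h2 : i = q ∧ j = p
  · obtain ⟨rfl, rfl⟩ := h2
    rw [if_pos rfl, if_neg hpq, if_neg hpq.symm, if_pos rfl, add_zero, zero_add, add_comm]
    have := h.small_shear φ hφ B hB
    linarith
  · have e1 := hone i j h1 h2
    have e2 := hone j i (fun h => h2 h.symm) (fun h => h1 h.symm)
    have e3 := abs_add_le ((if i = p then ∫ x, f x * partialDeriv j φ x else 0) +
        if i = q then ∫ x, g x * partialDeriv j φ x else 0)
      ((if j = p then ∫ x, f x * partialDeriv i φ x else 0) +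
        if j = q then ∫ x, g x * partialDeriv i φ x else 0)
    linarith

theorem restrict_eq_self_of_variation_compl (μ : SignedMeasure (RSpace n)) {s : Set (RSpace n)}
    (hs : MeasurableSet s) (h : μ.variation sᶜ = 0) : μ.restrict s = μ := by
  ext A hA
  rw [VectorMeasure.restrict_apply _ hs hA]
  have h1 : μ (A \ s) = 0 :=
    (VectorMeasure.variation_apply_eq_zero hs.compl).1 h _ (fun x hx => hx.2) (hA.diff hs)
  rw [← inter_union_sdiff A s, VectorMeasure.of_union ?_ (hA.inter hs) (hA.diff hs), h1, add_zero]
  · rw [inter_union_sdiff]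
  · exact disjoint_sdiff_inter.symm

theorem singularPart_eq_self (μ : SignedMeasure (RSpace n)) {s : Set (RSpace n)}
    (hs : MeasurableSet s) (h : μ.variation s = 0) (h' : volume sᶜ = 0) :
    μ.singularPart volume = μ := by
  refine (SignedMeasure.eq_singularPart μ 0 ?_ ?_).symm
  · rw [SignedMeasure.mutuallySingular_ennreal_iff, SignedMeasure.totalVariation_eq_variation,
      VectorMeasure.ennrealToMeasure_toENNRealVectorMeasure]
    exact ⟨s, hs, h, h'⟩
  · simp

/-- The strain of a Cantor pair is a measure carried by the compact set `K` and by the null set of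
points without rigid neighbourhood. -/
theorem IsCantorPair.exists_strain (h : IsCantorPair K p q f g C) (hpq : p ≠ q)
    (hK : IsClosed K) :
    ∃ μ : Fin n → Fin n → SignedMeasure (RSpace n),
      (∀ i j φ, IsTestFn univ φ → ∫ᵛ x, φ x ∂<•(μ i j) = strainPairing p q f g i j φ) ∧
      ∀ i j, (μ i j).variation Kᶜ = 0 ∧ (μ i j).variation {x | LocRigidAt p q f g x} = 0 := by
  choose μ hμ using fun i j => exists_signedMeasure_of_bounded (strainPairing p q f g i j) C
    (fun φ ψ hφ hψ => strainPairing_add h.cont_f h.cont_g hφ hψ i j)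
    (fun c φ hφ => strainPairing_smul hφ c i j)
    (fun φ hφ B hB => h.abs_strainPairing_le hpq hφ hB i j)
  refine ⟨μ, hμ, fun i j => ⟨?_, ?_⟩⟩
  · refine variation_eq_zero_of_forall_integral _ hK.isOpen_compl fun φ hφ => ?_
    rw [hμ i j φ (hφ.mono (subset_univ _))]
    refine strainPairing_eq_zero_of_rigid hpq h.cont_f h.cont_g hK.isOpen_compl (α := 0) ?_ hφ i j
    intro y hy z hz
    simp [h.off y hy, h.off z hz]
  · refine measure_null_of_locally_null _ fun x hx => ?_
    obtain ⟨α, U, hU, hxU, hα⟩ := LocRigidAt.exists_isOpen hx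
    refine ⟨U, mem_nhdsWithin_of_mem_nhds (hU.mem_nhds hxU), ?_⟩
    refine variation_eq_zero_of_forall_integral _ hU fun φ hφ => ?_
    rw [hμ i j φ (hφ.mono (subset_univ _))]
    exact strainPairing_eq_zero_of_rigid hpq h.cont_f h.cont_g hU hα hφ i j

theorem setIntegral_strain_eq {Ω : Set (RSpace n)} {φ : RSpace n → ℝ} (hφ : IsTestFn Ω φ)
    (i j : Fin n) :
    ∫ x in Ω, (pairField p q f g x i * partialDeriv j φ x +
      pairField p q f g x j * partialDeriv i φ x) / 2 = -strainPairing p q f g i j φ := by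
  rw [strainPairing, neg_neg]
  refine setIntegral_eq_integral_of_forall_compl_eq_zero fun x hx => ?_
  rw [hφ.partialDeriv_eq_zero i hx, hφ.partialDeriv_eq_zero j hx]
  simp

end Field

section Continuous

variable {n : ℕ}

theorem eq_of_tendsto_halfBall {u : RSpace n → RSpace n} (hu : Continuous u) {x a ν : RSpace n}
    (hν : ‖ν‖ = 1)
    (h : Tendsto (fun r : ℝ =>
        (∫⁻ y in Metric.ball x r ∩ {y | 0 < inner ℝ (y - x) ν}, ‖u y - a‖ₑ)
          / volume (Metric.ball x r)) (𝓝[>] 0) (𝓝 0)) : u x = a := by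
  by_contra hne
  have hpos : 0 < ‖u x - a‖ := norm_pos_iff.2 (sub_ne_zero.2 hne)
  set c := ‖u x - a‖ / 2 with hc
  have hc0 : 0 < c := half_pos hpos
  have hev : ∀ᶠ y in 𝓝 x, c < ‖u y - a‖ :=
    (hu.sub continuous_const).norm.continuousAt.eventually (lt_mem_nhds (by
      change c < ‖u x - a‖; linarith))
  obtain ⟨δ, hδ, hball⟩ := Metric.eventually_nhds_iff_ball.1 hev
  set κ : ℝ≥0∞ := ENNReal.ofReal c * ENNReal.ofReal ((1 / 2) ^ n) with hκ
  have hκ0 : 0 < κ := by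
    rw [hκ, ← ENNReal.ofReal_mul hc0.le]
    exact ENNReal.ofReal_pos.2 (by positivity)
  have h1 := (tendsto_order.1 h).2 κ hκ0
  have h2 : ∀ᶠ r : ℝ in 𝓝[>] 0, r ∈ Ioo 0 δ := Ioo_mem_nhdsGT hδ
  obtain ⟨r, hr1, hr0, hrδ⟩ := (h1.and h2).exists
  refine absurd hr1 (not_lt.2 ?_)
  have hv : volume (Metric.ball x r) = volume (Metric.ball (0 : RSpace n) r) :=
    Measure.addHaar_ball_center _ _ _
  have hv0 : volume (Metric.ball x r) ≠ 0 := (Metric.measure_ball_pos _ _ hr0).ne'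
  have hvt : volume (Metric.ball x r) ≠ ⊤ := measure_ball_lt_top.ne
  rw [ENNReal.le_div_iff_mul_le (Or.inl hv0) (Or.inl hvt)]
  have hsub : Metric.ball (x + (r / 2) • ν) (1 / 2 * r) ⊆
      Metric.ball x r ∩ {y | 0 < inner ℝ (y - x) ν} := fun y hy => by
    rw [mem_ball_iff_norm] at hy
    set w := y - (x + (r / 2) • ν) with hw
    have e : y - x = w + (r / 2) • ν := by rw [hw]; abel
    constructor
    · rw [mem_ball_iff_norm, e]
      refine (norm_add_le _ _).trans_lt ?_
      rw [norm_smul, hν, Real.norm_eq_abs, abs_of_pos (half_pos hr0)]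
      linarith
    · rw [mem_ofPred_eq, e, inner_add_left, inner_smul_left, real_inner_self_eq_norm_sq, hν]
      have h3 := neg_le_of_abs_le (abs_real_inner_le_norm w ν)
      rw [hν] at h3
      simp only [conj_trivial]
      linarith
  calc κ * volume (Metric.ball x r)
      = ENNReal.ofReal c * volume (Metric.ball (x + (r / 2) • ν) (1 / 2 * r)) := by
        rw [Measure.addHaar_ball_mul_of_pos _ _ (by norm_num), hκ, hv, mul_assoc]
        simp
    _ = ∫⁻ _ in Metric.ball (x + (r / 2) • ν) (1 / 2 * r), ENNReal.ofReal c := by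
        rw [setLIntegral_const]
    _ ≤ ∫⁻ y in Metric.ball (x + (r / 2) • ν) (1 / 2 * r), ‖u y - a‖ₑ := by
        refine setLIntegral_mono (by have := hu.measurable; fun_prop) fun y hy => ?_
        rw [← ofReal_norm]
        exact ENNReal.ofReal_le_ofReal
          (hball y (Metric.ball_subset_ball hrδ.le (hsub hy).1)).le
    _ ≤ _ := lintegral_mono_set hsub

theorem jumpSet_eq_empty_of_continuous {u : RSpace n → RSpace n} (hu : Continuous u)
    (Ω : Set (RSpace n)) : jumpSet Ω u = ∅ := by
  refine eq_empty_of_forall_notMem ?_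
  rintro x ⟨-, a, b, ν, hab, hν, ha, hb⟩
  refine hab ((eq_of_tendsto_halfBall hu hν ha).symm.trans
    (eq_of_tendsto_halfBall hu (ν := -ν) (by rwa [norm_neg]) ?_))
  simpa only [inner_neg_right, neg_pos] using hb

theorem hasApproxGradientAt_of_eventually {u : RSpace n → RSpace n} {L : RSpace n →L[ℝ] RSpace n}
    {x : RSpace n} (h : ∀ᶠ y in 𝓝 x, u y = u x + L (y - x)) : HasApproxGradientAt u L x := by
  refine ⟨u x, tendsto_const_nhds.congr' ?_⟩
  obtain ⟨δ, hδ, hball⟩ := Metric.eventually_nhds_iff_ball.1 h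
  filter_upwards [Ioo_mem_nhdsGT hδ] with r hr
  rw [setLIntegral_congr_fun (g := fun _ => 0) measurableSet_ball fun y hy => ?_]
  · simp
  · simp [hball y (Metric.ball_subset_ball hr.2.le hy)]

/-- If the weak derivative `∂_q f` is a measure on `V`, then it controls the classical derivative
on every open set where `f` is locally affine. -/
theorem lintegral_partialDeriv_le_variation {f : RSpace n → ℝ} (hf : Continuous f) {q : Fin n}
    {V S : Set (RSpace n)} (hV : IsOpen V) (hVc : IsCompact (closure V))
    (hS : ∀ x ∈ S, ∃ (α : ℝ) (U : Set (RSpace n)), IsOpen U ∧ x ∈ U ∧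
      ∀ y ∈ U, ∀ z ∈ U, f z = f y + α * (z q - y q))
    (ν : SignedMeasure (RSpace n))
    (hν : ∀ φ, IsTestFn V φ → ∫ x in V, f x * partialDeriv q φ x = -∫ᵛ x, φ x ∂<•ν) :
    ∫⁻ x in S ∩ V, ‖partialDeriv q f x‖ₑ ≤ ν.variation univ := by
  have hlocal : ∀ x ∈ S ∩ V, ∃ U, IsOpen U ∧ x ∈ U ∧ ∀ A ⊆ U, MeasurableSet A →
      ∫⁻ x in A, ‖partialDeriv q f x‖ₑ ≤ ν.variation A := by
    rintro x ⟨hxS, hxV⟩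
    obtain ⟨α, U', hU', hxU', hα'⟩ := hS x hxS
    set U := U' ∩ V
    have hU : IsOpen U := hU'.inter hV
    have hα : ∀ y ∈ U, ∀ z ∈ U, f z = f y + α * (z q - y q) :=
      fun y hy z hz => hα' y hy.1 z hz.1
    have : IsFiniteMeasure (volume.restrict U) := ⟨by
      rw [Measure.restrict_apply_univ]
      exact (measure_mono (inter_subset_right.trans subset_closure)).trans_lt hVc.measure_lt_top⟩
    set m : SignedMeasure (RSpace n) := (volume.restrict U).toSignedMeasure with hm
    have hz : (ν - α • m).variation U = 0 := by
      refine variation_eq_zero_of_forall_integral _ hU fun φ hφ => ?_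
      have hI : ∀ μ : SignedMeasure (RSpace n), μ.Integrable φ := fun μ =>
        hφ.1.continuous.integrable_of_hasCompactSupport hφ.2.1
      rw [VectorMeasure.integral_sub_vectorMeasure (hI _) (hI _),
        VectorMeasure.integral_smul_vectorMeasure, hm, VectorMeasure.integral_toSignedMeasure]
      have h1 := hν φ (hφ.mono inter_subset_right)
      rw [setIntegral_eq_integral_of_forall_compl_eq_zero fun y hy => by
          rw [(hφ.mono inter_subset_right).partialDeriv_eq_zero q hy, mul_zero],
        integral_mul_partialDeriv_of_affine hU hf hα hφ, if_pos rfl, neg_inj] at h1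
      rw [← h1, setIntegral_eq_integral_of_forall_compl_eq_zero fun y hy =>
        image_eq_zero_of_notMem_tsupport fun h => hy (hφ.2.2 h), smul_eq_mul, sub_self]
    refine ⟨U, hU, ⟨hxU', hxV⟩, fun A hA hAm => ?_⟩
    have h2 : ν A = α * (volume A).toReal := by
      have h3 := (VectorMeasure.variation_apply_eq_zero hU.measurableSet).1 hz A hA hAm
      have h4 : ν A - α * m A = 0 := h3
      rw [hm, Measure.toSignedMeasure_apply_measurable hAm, measureReal_restrict_apply hAm,
        inter_eq_self_of_subset_left hA] at h4
      exact sub_eq_zero.1 h4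
    have hAt : volume A ≠ ⊤ := ((measure_mono (hA.trans (inter_subset_right.trans
      subset_closure))).trans_lt hVc.measure_lt_top).ne
    calc ∫⁻ x in A, ‖partialDeriv q f x‖ₑ = ∫⁻ _ in A, ‖α‖ₑ :=
          setLIntegral_congr_fun hAm fun y hy => by
            rw [partialDeriv_of_eventually_affine (α := α)]
            filter_upwards [hU.mem_nhds (hA hy)] with z hz using hα y (hA hy) z hz
      _ = ‖ν A‖ₑ := by
          rw [setLIntegral_const, h2, enorm_mul, Real.enorm_of_nonneg ENNReal.toReal_nonneg,
            ENNReal.ofReal_toReal hAt]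
      _ ≤ ν.variation A := VectorMeasure.enorm_measure_le_variation _ _
  choose! U hU hxU hUle using hlocal
  obtain ⟨T, hTS, hTc, hTU⟩ := TopologicalSpace.isOpen_biUnion_countable (S ∩ V) U hU
  have hcov : S ∩ V ⊆ ⋃ x ∈ T, U x := fun x hx => by
    rw [hTU]; exact mem_biUnion hx (hxU x hx)
  rcases T.eq_empty_or_nonempty with rfl | hTne
  · have : S ∩ V = ∅ := by simpa using hcov
    simp [this]
  obtain ⟨e, he⟩ := hTc.exists_eq_range hTne
  have heT : ∀ k, e k ∈ S ∩ V := fun k => hTS (he ▸ mem_range_self k)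
  have hm : ∀ k, MeasurableSet (disjointed (fun k => U (e k)) k) :=
    MeasurableSet.disjointed fun k => (hU _ (heT k)).measurableSet
  calc ∫⁻ x in S ∩ V, ‖partialDeriv q f x‖ₑ
      ≤ ∫⁻ x in ⋃ k, disjointed (fun k => U (e k)) k, ‖partialDeriv q f x‖ₑ := by
        refine lintegral_mono_set (hcov.trans ?_)
        rw [iUnion_disjointed, he, biUnion_range]
    _ = ∑' k, ∫⁻ x in disjointed (fun k => U (e k)) k, ‖partialDeriv q f x‖ₑ :=
        lintegral_iUnion hm (disjoint_disjointed _) _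
    _ ≤ ∑' k, ν.variation (disjointed (fun k => U (e k)) k) :=
        ENNReal.tsum_le_tsum fun k => hUle _ (heT k) _ (disjointed_subset _ _) (hm k)
    _ = ν.variation (⋃ k, disjointed (fun k => U (e k)) k) :=
        (measure_iUnion (disjoint_disjointed _) hm).symm
    _ ≤ _ := measure_mono (subset_univ _)

end Continuous

section Main

variable {n : ℕ} {K : Set (RSpace n)} {p q : Fin n} {f g : RSpace n → ℝ} {C : ℝ}

theorem IsCantorPair.lintegral_inter (h : IsCantorPair K p q f g C) (hK : IsClosed K)
    {V : Set (RSpace n)} (hV : MeasurableSet V) (hKV : K ⊆ V) :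
    ∫⁻ x in {x | LocRigidAt p q f g x} ∩ V, ‖partialDeriv q f x‖ₑ = ⊤ := by
  have hS := (isOpen_setOf_locRigidAt p q f g).measurableSet
  rw [← h.large, ← lintegral_inter_add_sdiff _ {x | LocRigidAt p q f g x} hV,
    setLIntegral_congr_fun (g := fun _ => 0) (hS.diff hV) fun x hx => ?_]
  · simp
  · beta_reduce
    rw [partialDeriv_of_eventually_affine (α := 0), enorm_zero]
    filter_upwards [hK.isOpen_compl.mem_nhds fun hxK => hx.2 (hKV hxK)] with y hy
    rw [(h.off y hy).1, (h.off x fun hxK => hx.2 (hKV hxK)).1]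
    ring

theorem pairField_apply_left (hpq : p ≠ q) (y : RSpace n) : pairField p q f g y p = f y := by
  simp [pairField_apply, hpq]

theorem IsCantorPair.hasCompactSupport (h : IsCantorPair K p q f g C) (hK : IsCompact K) :
    HasCompactSupport (pairField p q f g) :=
  HasCompactSupport.intro hK fun x hx => by simp [pairField, h.off x hx]

theorem IsCantorPair.not_inGBV (h : IsCantorPair K p q f g C) (hpq : p ≠ q) (hK : IsCompact K)
    {Ω : Set (RSpace n)} (hΩ : IsOpen Ω) (hKΩ : K ⊆ Ω) : ¬ InGBV Ω (pairField p q f g) := by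
  rintro ⟨-, hbv⟩
  obtain ⟨R, hR⟩ := (h.hasCompactSupport hK).exists_bound_of_continuous
    (continuous_pairField h.cont_f h.cont_g)
  have hR0 : 0 ≤ R := (norm_nonneg _).trans (hR 0)
  let χ : ContDiffBump (0 : RSpace n) := ⟨R + 1, R + 2, by linarith, by linarith⟩
  let φ : RSpace n → ℝ := fun z => χ z * z p
  have hφ : ContDiff ℝ 1 φ :=
    χ.contDiff.mul (EuclideanSpace.proj p : RSpace n →L[ℝ] ℝ).contDiff
  have hφc : HasCompactSupport φ := χ.hasCompactSupport.mul_right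
  have hφu : (fun x => φ (pairField p q f g x)) = f := by
    ext x
    have : χ (pairField p q f g x) = 1 := χ.one_of_mem_closedBall (by
      rw [mem_closedBall_zero_iff]
      change _ ≤ R + 1
      linarith [hR x])
    simp only [φ, this, one_mul, pairField_apply_left hpq]
  obtain ⟨V, hV, hKV, hVΩ, hVc⟩ := exists_open_between_and_isCompact_closure hK hΩ hKΩ
  obtain ⟨-, ν, hν⟩ := hbv φ hφ (hφc.fderiv ℝ) V hV hVc hVΩ
  rw [hφu] at hν
  have hle := lintegral_partialDeriv_le_variation h.cont_f hV hVc
    (S := {x | LocRigidAt p q f g x}) (fun x hx => by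
      obtain ⟨α, U, hU, hxU, hα⟩ := LocRigidAt.exists_isOpen hx
      exact ⟨α, U, hU, hxU, fun y hy z hz => (hα y hy z hz).1⟩) (ν q) (hν q).2
  rw [h.lintegral_inter hK.isClosed hV.measurableSet hKV, top_le_iff] at hle
  exact measure_ne_top _ _ hle

/-- The gradient of `f e_p + g e_q` at a point with a rigid neighbourhood. -/
theorem LocRigidAt.exists_gradient {x : RSpace n} (h : LocRigidAt p q f g x) (hpq : p ≠ q) :
    (∀ᶠ y in 𝓝 x, pairField p q f g y =
      pairField p q f g x + fderiv ℝ (pairField p q f g) x (y - x)) ∧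
      ‖partialDeriv q f x‖ₑ ≤ ‖fderiv ℝ (pairField p q f g) x‖ₑ := by
  obtain ⟨α, hα⟩ := h
  let L : RSpace n →L[ℝ] RSpace n :=
    (α • (EuclideanSpace.proj q : RSpace n →L[ℝ] ℝ)).smulRight (EuclideanSpace.single p 1) -
      (α • (EuclideanSpace.proj p : RSpace n →L[ℝ] ℝ)).smulRight (EuclideanSpace.single q 1)
  have hev : ∀ᶠ y in 𝓝 x, pairField p q f g y = pairField p q f g x + L (y - x) := by
    filter_upwards [hα] with y hy
    have hL : L (y - x) = (α * (y q - x q)) • EuclideanSpace.single p (1 : ℝ) -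
        (α * (y p - x p)) • EuclideanSpace.single q (1 : ℝ) := rfl
    rw [hL, pairField, pairField, hy.1, hy.2]
    module
  have hd : HasFDerivAt (pairField p q f g) L x := by
    have h1 : HasFDerivAt (fun y => pairField p q f g x + L (y - x)) L x :=
      (L.hasFDerivAt.comp x ((hasFDerivAt_id x).sub_const x)).const_add _
    exact h1.congr_of_eventuallyEq hev
  rw [hd.fderiv]
  refine ⟨hev, ?_⟩
  rw [partialDeriv_of_eventually_affine (hα.mono fun y hy => hy.1), enorm_le_iff_norm_le]
  have h1 : (L (EuclideanSpace.single q 1)) p = α := by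
    simp [L, hpq]
  calc ‖α‖ = ‖(L (EuclideanSpace.single q 1)) p‖ := by rw [h1]
    _ ≤ ‖L (EuclideanSpace.single q 1)‖ := PiLp.norm_apply_le _ _
    _ ≤ ‖L‖ * ‖(EuclideanSpace.single q 1 : RSpace n)‖ := L.le_opNorm _
    _ = ‖L‖ := by simp

end Main

theorem theorem3p5 (n : ℕ) (hn : 2 ≤ n) (Ω : Set (RSpace n)) (hΩ : IsOpen Ω)
    (hne : Ω.Nonempty) :
    ∃ u : RSpace n → RSpace n,
      InBD Ω u ∧
      MemLp u ∞ (volume.restrict Ω) ∧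
      (∃ Eu : Fin n → Fin n → SignedMeasure (RSpace n),
        IsStrainMeasure Ω u Eu ∧ Eu = cantorPart Ω u Eu) ∧
      (∃ gradu : RSpace n → (RSpace n →L[ℝ] RSpace n),
        AEStronglyMeasurable gradu (volume.restrict Ω) ∧
        (∀ᵐ x ∂(volume.restrict Ω), HasApproxGradientAt u (gradu x) x) ∧
        ¬ IntegrableOn gradu Ω) ∧
      ¬ InGBV Ω u := by
  obtain ⟨c, hc⟩ := hne
  obtain ⟨δ, hδ, hball⟩ := Metric.isOpen_iff.1 hΩ c hc
  set r := δ / (√n + 1) with hr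
  have hr0 : 0 < r := by positivity
  have hKΩ : cube c r ⊆ Ω := by
    refine (cube_subset_closedBall c hr0.le).trans ((Metric.closedBall_subset_ball ?_).trans hball)
    rw [hr, mul_div_assoc', div_lt_iff₀ (by positivity)]
    nlinarith
  have hK : IsCompact (cube c r) := isCompact_cube c hr0.le
  let p : Fin n := ⟨0, by lia⟩
  let q : Fin n := ⟨1, by lia⟩
  have hpq : p ≠ q := by simp [p, q]
  obtain ⟨f, g, C, h⟩ := exists_isCantorPair p q c hr0
  obtain ⟨μ, hμ, hμ0⟩ := h.exists_strain hpq hK.isClosed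
  have hu : Continuous (pairField p q f g) := continuous_pairField h.cont_f h.cont_g
  have hcs := h.hasCompactSupport hK
  have hstrain : IsStrainMeasure Ω (pairField p q f g) μ := fun i j => by
    refine ⟨restrict_eq_self_of_variation_compl _ hΩ.measurableSet
      (measure_mono_null (compl_subset_compl.2 hKΩ) (hμ0 i j).1), fun φ hφ => ?_⟩
    rw [setIntegral_strain_eq hφ, hμ i j φ (hφ.mono (subset_univ _))]
  obtain ⟨R, hR⟩ := hcs.exists_bound_of_continuous hu
  have hS := (isOpen_setOf_locRigidAt p q f g).measurableSet
  refine ⟨pairField p q f g, ⟨(hu.integrable_of_hasCompactSupport hcs).integrableOn, μ, hstrain⟩,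
    memLp_top_of_bound hu.aestronglyMeasurable R (Eventually.of_forall hR),
    ⟨μ, hstrain, ?_⟩, ⟨fderiv ℝ (pairField p q f g), ?_, ?_, fun hint => ?_⟩,
    h.not_inGBV hpq hK hΩ hKΩ⟩
  · ext1 i
    ext1 j
    rw [cantorPart, jumpSet_eq_empty_of_continuous hu, sdiff_empty,
      singularPart_eq_self _ hS (hμ0 i j).2 h.rigid, (hstrain i j).1]
  · exact (measurable_fderiv ℝ _).aestronglyMeasurable
  · filter_upwards [ae_restrict_of_ae h.rigid] with x hx
    exact hasApproxGradientAt_of_eventually (hx.exists_gradient hpq).1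
  · refine hint.2.ne (top_le_iff.1 ?_)
    calc (⊤ : ℝ≥0∞)
        = ∫⁻ x in {x | LocRigidAt p q f g x} ∩ Ω, ‖partialDeriv q f x‖ₑ :=
          (h.lintegral_inter hK.isClosed hΩ.measurableSet hKΩ).symm
      _ ≤ ∫⁻ x in {x | LocRigidAt p q f g x} ∩ Ω, ‖fderiv ℝ (pairField p q f g) x‖ₑ :=
          setLIntegral_mono (measurable_fderiv ℝ _).enorm fun x hx =>
            (LocRigidAt.exists_gradient hx.1 hpq).2
      _ ≤ _ := lintegral_mono_set inter_subset_right
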